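/- **Setting.** Let $n\ge 0$, $m\ge1$, let $\mathcal X\subseteq\mathbb R^n$ be a Borel set, $f,c_1,\dots,c_m:\mathcal X\to\mathbb R$, $\mathcal D=\{x\in\mathcal X: c_j(x)\le 0\ \forall j\}$, and $h(x)=\sum_{j}\max\{c_j(x),0\}$ for $x\in\mathcal X$. The problem is $\min_{x\in\mathcal D}f(x)$. Assume that $f$ and $h$ are locally Lipschitz on $\mathcal X$, the $c_j$ are continuous on $\mathcal X$, and $f$ is bounded below on $\mathcal X$. *Nonsmooth notions.* For $g:\mathcal X\to\mathbb R$ and $\hat x\in\mathcal X$, $g^\circ(\hat x;v)=\limsup (g(y+tv)-g(y))/t$ over $y\to\hat x$, $t\searrow0$ with $y\in\mathcal X$, $y+tv\in\mathcal X$. For $\mathcal O\subseteq\mathcal X$, $T^H_{\mathcal O}(\hat x)$ is the set of $v$ for which there is $\epsilon>0$ with $y+tw\in\mathcal O$ for all $y\in\mathcal O\cap B_\epsilon(\hat x)$, $w\in B_\epsilon(v)$, $0<t<\epsilon$; the Clarke tangent cone $T^{Cl}_{\mathcal O}(\hat x)$ is the set of $v$ such that for all sequences $y_k\to\hat x$ in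 $\mathcal O$ and $0<t_k\to0$ there are $w_k\to v$ with $y_k+t_kw_k\in\mathcal O$. The point $\hat x$ is Clarke stationary for $\min_{\mathcal O}g$ if $\hat x\in\mathcal O$ and $g^\circ(\hat x;v)\ge0$ for all $v\in T^{Cl}_{\mathcal O}(\hat x)$. *Algorithm (StoMADS-PB).* Parameters: $x^0\in\mathcal X$, $\delta_p^0>0$, $\tau\in(0,1)\cap\mathbb Q$, $\varepsilon>0$, $\gamma>2$, an integer $\hat z\ge1$, and a matrix $\mathbf D$ whose columns positively span $\mathbb R^n$; $b$ is the largest $\|\cdot\|_\infty$-norm of a column. Start with $x^0_{\inf}=x^0_{\rm feas}=x^0$ and flag FALSE. At iteration $k$, put $\delta_m^k=\min\{\delta_p^k,(\delta_p^k)^2\}$; the set of incumbents $\mathcal V^k$ is $\{x^k_{\inf}\}$ if the flag is FALSE and $\{x^k_{\inf},x^k_{\rm feas}\}$ otherwise. Around each incumbent $x$, a finite positive spanning set $\mathbb D_p^k(x)$ of nonzero polling directions $d$ is used, with $x+\delta_m^kd$ in the mesh $\{y+\delta_m^k\mathbf Dz:y\in\mathcal V^k,z\ \text{integer}\}$ and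 $\delta_m^k\|d\|_\infty\le\delta_p^kb$. The evaluated trial points are the points $x+\delta_m^kd\in\mathcal X$. Estimates $f_0^k,c_{j,0}^k$ of $f,c_j$ at incumbents and $f_s^k,c_{j,s}^k$ at trial points give $h_\bullet^k=\sum_j\max\{c_{j,\bullet}^k,0\}$, $\ell_\bullet^k=\sum_j\max\{c_{j,\bullet}^k-\varepsilon(\delta_p^k)^2,0\}$, $u_\bullet^k=\sum_j\max\{c_{j,\bullet}^k+\varepsilon(\delta_p^k)^2,0\}$ ($\bullet\in\{0,s\}$). (1) *$f$-Dominating:* if some evaluated trial point has $u_s^k=0$ and, when the flag is TRUE, also $f_s^k-f_0^k(x^k_{\rm feas})\le-\gamma\varepsilon(\delta_p^k)^2$, then such a point becomes $x^{k+1}_{\rm feas}$ and the flag becomes TRUE. (2) *$h$-Dominating:* otherwise, if some evaluated trial point around $x^k_{\inf}$ has $f_s^k-f_0^k(x^k_{\inf})\le-\gamma\varepsilon(\delta^k_p)^2$, $h_s^k-h_0^k(x^k_{\inf})\le-\gamma m\varepsilon(\delta_p^k)^2$ and $0<u_s^k\le u_0^k(x^k_{\inf})$, then such a point becomes $x^{k+1}_{\inf}$.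 (3) *Improving:* otherwise, if some evaluated trial point around $x^k_{\inf}$ has $h_s^k-h_0^k(x^k_{\inf})\le-\gamma m\varepsilon(\delta_p^k)^2$, then one of these with least $u^k_s$ becomes $x^{k+1}_{\inf}$. In cases (1)–(3), $\delta_p^{k+1}=\min\{\tau^{-1}\delta_p^k,\tau^{-\hat z}\}$. (4) *Unsuccessful:* otherwise $\delta_p^{k+1}=\tau\delta_p^k$. What is not mentioned is unchanged. *Randomness.* The estimates are random variables on a probability space; this makes all quantities random (capital letters). Let $\mathcal F_{k-1}$ be the $\sigma$-algebra generated by the estimates of iterations $0,\dots,k-1$; the incumbents, flag, poll size and polling directions of iteration $k$ are $\mathcal F_{k-1}$-measurable. All iterates lie in one compact subset of $\mathcal X$, and there is $d_{\min}>0$ with $\delta_p^k\|d\|_\infty\ge d_{\min}$ for all polling directions. Let $T=\inf\{k: X^{\ell}_{\rm feas}\ne x^0\text{ for some }\ell\le k\}$; assume that $T$ is almost surely finite or almost surely infinite. Let $\alpha,\beta,\nu\in(0,1)$ satisfy $$\frac{\nu}{1-\nu}\ge\frac{2(\tau^{-2}-1)}{\gamma-2},\qquad \alpha\beta\ge\frac{4\nu}{(1-\nu)(1-\tau^2)}\Big[\sqrt{1-\alpha}+2\sqrt{1-\beta}\Big],\qquad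 \alpha\beta\in(1/2,1).$$ Assume for every $k$, almost surely, where "all points" means all incumbents and all evaluated trial points of iteration $k$: (i) $\mathbb P(\text{all estimates of } f \text{ are within }\varepsilon(\Delta_p^k)^2\text{ at all points}\mid\mathcal F_{k-1})\ge\beta$; (ii) $\mathbb E[E^2\mid\mathcal F_{k-1}]\le\varepsilon^2(1-\sqrt\beta)(\Delta_p^k)^4$, both for $E$ the largest error of the estimates of $f$ over the incumbents and for $E$ the largest one over the evaluated trial points, with $E^2$ integrable; (iii), (iv) the same for each $c_j$, with $\beta$ replaced by $\alpha^{1/m}$; (v) $\mathbb P(\ell^k\le h\le u^k\text{ at all points}\mid\mathcal F_{k-1})\ge\alpha$; (vi) $\mathbb E[E\mid\mathcal F_{k-1}]\le m\varepsilon\sqrt{1-\alpha}\,(\Delta_p^k)^2$, both for $E$ the largest error of the estimates $h_\bullet^k$ of $h$ over the incumbents and for $E$ the largest one over the evaluated trial points, with $E$ integrable. *Refining subsequences.* For one realization and an infinite set $\mathcal K\subseteq\mathbb N$, points $x^k$ $(k\in\mathcal K)$ form a refining subsequence with refined point $\hat x$ if $x^k\to\hat x$ and $\delta_m^k\to0$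 along $\mathcal K$. A refining direction for $\hat x$ is a limit $v=\lim_{k\in\mathcal L}d^k/\|d^k\|_\infty$ with $\mathcal L\subseteq\mathcal K$ infinite and $d^k\in\mathbb D_p^k(x^k)$. A set of directions is called dense in a cone $C$ if the positive multiples of its elements are dense in $C$. For $g\in\{f,h\}$, "$\lim_{\mathcal K}\psi_k^g\le0$" means that $\limsup_{k\in\mathcal K}\max_d\,(g(x^k)-g(x^k+\delta_m^kd))/\delta_p^k\le0$, the maximum being over $d\in\mathbb D_p^k(x^k)$ with $x^k+\delta_m^kd\in\mathcal X$. **Theorem.** (a) *(Violation function.)* Almost surely there is an infinite $\mathcal K$ such that $\{x^k_{\inf}\}_{k\in\mathcal K}$ is a refining subsequence with refined point in $\mathcal X$ and $\lim_{\mathcal K}\psi_k^h\le0$. For every realization and every refining subsequence $\{x^k_{\inf}\}_{k\in\mathcal K}$ with $\lim_{\mathcal K}\psi_k^h\le0$ and refined point $\hat x_{\inf}$: if the set of refining directions for $\hat x_{\inf}$ is dense in $T^H_{\mathcal X}(\hat x_{\inf})\ne\emptyset$, then $\hat x_{\inf}$ is a Clarke stationary point of $\min_{x\in\mathcal X}h(x)$.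 (b) *(Objective.)* Suppose $T<\infty$ almost surely. Then almost surely, with $t$ the realization of $T$, every refining subsequence $\{x^{k\vee t}_{\rm feas}\}_{k\in\mathcal K}$ with $\lim_{\mathcal K}\psi_k^f\le0$ and $\lim_{k\in\mathcal K}h_0^{k\vee t}(x^{k\vee t}_{\rm feas})=0$ has its refined point $\hat x_{\rm feas}$ in $\mathcal D$; and if the set of refining directions for $\hat x_{\rm feas}$ is dense in $T^H_{\mathcal D}(\hat x_{\rm feas})\ne\emptyset$, and either $x^{k\vee t}_{\rm feas}\in\mathcal D$ for all large $k\in\mathcal K$ or $T^H_{\mathcal D}(\hat x_{\rm feas})\subseteq T^H_{\mathcal X}(\hat x_{\rm feas})$ (as is the case when $\mathcal X$ is convex), then $\hat x_{\rm feas}$ is a Clarke stationary point of $\min_{x\in\mathcal D}f(x)$. -/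

import Mathlib

open Filter Topology MeasureTheory Set

/-! ### Nonsmooth analysis -/

/-- Points of `ℝⁿ`; the norm is the sup norm `‖·‖_∞`. -/
abbrev Vec (n : ℕ) : Type := Fin n → ℝ

/-- Clarke generalized derivative of `g` at `x` in the direction `v`, for a function `g` that is
meaningful on `X` only: the limsup of `(g (y + t v) - g y) / t` over `y → x`, `t ↘ 0` with
`y ∈ X` and `y + t v ∈ X`. It takes values in `[-∞, +∞]`. -/
noncomputable def clarkeDeriv {n : ℕ} (X : Set (Vec n)) (g : Vec n → ℝ) (x v : Vec n) : EReal :=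
  limsup (fun q : Vec n × ℝ => (((g (q.1 + q.2 • v) - g q.1) / q.2 : ℝ) : EReal))
    ((𝓝 x ×ˢ 𝓝[>] (0 : ℝ)) ⊓ 𝓟 {q | q.1 ∈ X ∧ q.1 + q.2 • v ∈ X})

/-- Hypertangent cone to `O` at `x`. -/
def hypertangentCone {n : ℕ} (O : Set (Vec n)) (x : Vec n) : Set (Vec n) :=
  {v | ∃ ε : ℝ, 0 < ε ∧ ∀ y ∈ O ∩ Metric.ball x ε, ∀ w ∈ Metric.ball v ε,
    ∀ t : ℝ, 0 < t → t < ε → y + t • w ∈ O}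

/-- Clarke tangent cone to `O` at `x`. -/
def clarkeTangentCone {n : ℕ} (O : Set (Vec n)) (x : Vec n) : Set (Vec n) :=
  {v | ∀ (y : ℕ → Vec n) (t : ℕ → ℝ), (∀ k, y k ∈ O) → Tendsto y atTop (𝓝 x) →
    (∀ k, 0 < t k) → Tendsto t atTop (𝓝 0) →
    ∃ w : ℕ → Vec n, Tendsto w atTop (𝓝 v) ∧ ∀ k, y k + t k • w k ∈ O}

/-- `x` is a Clarke stationary point of `min_{O} g`, where `g` is defined on `X ⊇ O`. -/
def IsClarkeStationary {n : ℕ} (X : Set (Vec n)) (g : Vec n → ℝ) (O : Set (Vec n))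
    (x : Vec n) : Prop :=
  x ∈ O ∧ ∀ v ∈ clarkeTangentCone O x, 0 ≤ clarkeDeriv X g x v

/-! ### Refining subsequences and refining directions of one realization -/

/-- `{x k}_{k ∈ K}` is a refining subsequence (with mesh sizes `δm k`) with refined point `xhat`. -/
def IsRefining {n : ℕ} (x : ℕ → Vec n) (δm : ℕ → ℝ) (K : Set ℕ) (xhat : Vec n) : Prop :=
  K.Infinite ∧ Tendsto x (atTop ⊓ 𝓟 K) (𝓝 xhat) ∧ Tendsto δm (atTop ⊓ 𝓟 K) (𝓝 0)

/-- The refining directions of a refining subsequence indexed by `K`, when `D k` is the set of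
polling directions around its `k`-th point. -/
def refiningDirections {n : ℕ} (D : ℕ → Set (Vec n)) (K : Set ℕ) : Set (Vec n) :=
  {v | ∃ L : Set ℕ, L ⊆ K ∧ L.Infinite ∧ ∃ d : ℕ → Vec n, (∀ k ∈ L, d k ∈ D k) ∧
    Tendsto (fun k => ‖d k‖⁻¹ • d k) (atTop ⊓ 𝓟 L) (𝓝 v)}

/-- A set `R` of directions is dense in the cone `T`: directions matter up to a positive factor
(refining directions are normalized, the elements of a cone are not), so this says that the
positive multiples of elements of `R` are dense in `T`. -/
def DirectionsDenseIn {n : ℕ} (R T : Set (Vec n)) : Prop :=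
  T ⊆ closure {w | ∃ t : ℝ, 0 < t ∧ ∃ r ∈ R, w = t • r}

/-- `lim_{k ∈ K} ψ_k ≤ 0` where `ψ_k = (g (x k) - g (x k + δm k d)) / δp k`, for any available
polling direction `d` (uniformly in `d ∈ D k` with `x k + δm k d ∈ X`). -/
def PsiLimNonpos {n : ℕ} (X : Set (Vec n)) (g : Vec n → ℝ) (x : ℕ → Vec n) (δm δp : ℕ → ℝ)
    (D : ℕ → Set (Vec n)) (K : Set ℕ) : Prop :=
  ∀ η : ℝ, 0 < η → ∀ᶠ k in atTop ⊓ 𝓟 K, ∀ d ∈ D k, x k + δm k • d ∈ X →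
    (g (x k) - g (x k + δm k • d)) / δp k ≤ η

/-- The family `d` is a positive spanning set of `ℝⁿ`. -/
def PositivelySpans {n : ℕ} {ι : Type} [Fintype ι] (d : ι → Vec n) : Prop :=
  ∀ v : Vec n, ∃ a : ι → ℝ, (∀ i, 0 ≤ a i) ∧ v = ∑ i, a i • d i

/-! ### The optimization problem -/

/-- Data of `min {f x : x ∈ X, c_j x ≤ 0 for all j}`. Only values of `f` and `c` on `X` matter. -/
structure Problem (n m : ℕ) where
  X : Set (Vec n)
  f : Vec n → ℝ
  c : Fin m → Vec n → ℝ

namespace Problem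

variable {n m : ℕ} (P : Problem n m)

/-- Feasible region. -/
def feasible : Set (Vec n) := {x | x ∈ P.X ∧ ∀ j, P.c j x ≤ 0}

/-- Constraint violation function on `X` (it is `+∞` outside `X`; every use below is restricted
to points of `X`). -/
noncomputable def h (x : Vec n) : ℝ := ∑ j, max (P.c j x) 0

end Problem

/-! ### The algorithm -/

/-- Initialization of the algorithm. The columns of the mesh matrix are `col 0, …, col (p-1)`. -/
structure Params (n : ℕ) where
  x0 : Vec n
  δ0 : ℝ
  δ0_pos : 0 < δ0
  τ : ℚ
  τ_pos : 0 < τ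
  τ_lt_one : τ < 1
  ε : ℝ
  ε_pos : 0 < ε
  γ : ℝ
  two_lt_γ : 2 < γ
  zhat : ℕ
  zhat_pos : 0 < zhat
  p : ℕ
  col : Fin p → Vec n
  col_spans : PositivelySpans col

/-- The two incumbents: the `ε`-infeasible one and the `ε`-feasible one. -/
inductive Center : Type
  | inf : Center
  | feas : Center

/-- The random quantities of a run. At iteration `k` the polling directions around the incumbent
`a` are listed as `dir k a i`, `i < N k` (repetitions allowed), with trial points
`x k a + δ_m^k dir k a i`. `F0`, `C0` are the estimates of `f`, `c_j` at the incumbents, and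
`Fs`, `Cs` those at the trial points. `flag` is the feasibility success flag. -/
structure StoMADSRun (n m : ℕ) (Ω : Type*) where
  x : ℕ → Center → Ω → Vec n
  flag : ℕ → Ω → Bool
  δp : ℕ → Ω → ℝ
  N : ℕ → ℕ
  dir : (k : ℕ) → Center → Fin (N k) → Ω → Vec n
  F0 : ℕ → Center → Ω → ℝ
  Fs : (k : ℕ) → Center → Fin (N k) → Ω → ℝ
  C0 : ℕ → Center → Fin m → Ω → ℝ
  Cs : (k : ℕ) → Center → Fin (N k) → Fin m → Ω → ℝ

namespace StoMADSRun

variable {n m : ℕ} {Ω : Type*} (P : Problem n m) (A : Params n) (R : StoMADSRun n m Ω)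

/-- Mesh size parameter. -/
noncomputable def δm (k : ℕ) (ω : Ω) : ℝ := min (R.δp k ω) (R.δp k ω ^ 2)

/-- Trial points `x^k + s^k`, `s^k = δ_m^k d^k`. -/
noncomputable def trial (k : ℕ) (a : Center) (i : Fin (R.N k)) (ω : Ω) : Vec n :=
  R.x k a ω + R.δm k ω • R.dir k a i ω

/-- `a` belongs to the set `𝒱^k` of incumbents of iteration `k`. -/
def Avail (k : ℕ) (a : Center) (ω : Ω) : Prop := a = Center.inf ∨ R.flag k ω = true

/-- The set of polling directions around the incumbent `a` at iteration `k`. -/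
def pollDirs (k : ℕ) (a : Center) (ω : Ω) : Set (Vec n) := Set.range fun i => R.dir k a i ω

/-- The trial point `(a, i)` belongs to the poll set of iteration `k`, i.e. it is evaluated. -/
def Evaluated (k : ℕ) (a : Center) (i : Fin (R.N k)) (ω : Ω) : Prop :=
  R.Avail k a ω ∧ R.trial k a i ω ∈ P.X

/-- Mesh of iteration `k`. -/
def mesh (k : ℕ) (ω : Ω) : Set (Vec n) :=
  {y | ∃ a, R.Avail k a ω ∧ ∃ z : Fin A.p → ℤ,
    y = R.x k a ω + R.δm k ω • ∑ j, (z j : ℝ) • A.col j}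

/-- Estimated violation at an incumbent. -/
noncomputable def h0 (k : ℕ) (a : Center) (ω : Ω) : ℝ := ∑ j, max (R.C0 k a j ω) 0

/-- Estimated violation at a trial point. -/
noncomputable def hs (k : ℕ) (a : Center) (i : Fin (R.N k)) (ω : Ω) : ℝ :=
  ∑ j, max (R.Cs k a i j ω) 0

/-- Lower bound `ℓ_0^k` at an incumbent. -/
noncomputable def l0 (k : ℕ) (a : Center) (ω : Ω) : ℝ :=
  ∑ j, max (R.C0 k a j ω - A.ε * R.δp k ω ^ 2) 0

/-- Upper bound `u_0^k` at an incumbent. -/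
noncomputable def u0 (k : ℕ) (a : Center) (ω : Ω) : ℝ :=
  ∑ j, max (R.C0 k a j ω + A.ε * R.δp k ω ^ 2) 0

/-- Lower bound `ℓ_s^k` at a trial point. -/
noncomputable def ls (k : ℕ) (a : Center) (i : Fin (R.N k)) (ω : Ω) : ℝ :=
  ∑ j, max (R.Cs k a i j ω - A.ε * R.δp k ω ^ 2) 0

/-- Upper bound `u_s^k` at a trial point. -/
noncomputable def us (k : ℕ) (a : Center) (i : Fin (R.N k)) (ω : Ω) : ℝ :=
  ∑ j, max (R.Cs k a i j ω + A.ε * R.δp k ω ^ 2) 0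

/-- Barrier threshold. -/
noncomputable def hmax (k : ℕ) (ω : Ω) : ℝ := R.u0 A k Center.inf ω

/-- The trial point `(a, i)` makes the iteration `f`-Dominating. -/
def FDomAt (k : ℕ) (a : Center) (i : Fin (R.N k)) (ω : Ω) : Prop :=
  R.Evaluated P k a i ω ∧ R.us A k a i ω = 0 ∧
    (R.flag k ω = true →
      R.Fs k a i ω - R.F0 k Center.feas ω ≤ -(A.γ * A.ε * R.δp k ω ^ 2))

/-- The trial point `i` around the `ε`-infeasible incumbent dominates this incumbent. -/
def HDomAt (k : ℕ) (i : Fin (R.N k)) (ω : Ω) : Prop :=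
  R.Evaluated P k Center.inf i ω ∧
    R.Fs k Center.inf i ω - R.F0 k Center.inf ω ≤ -(A.γ * A.ε * R.δp k ω ^ 2) ∧
    R.hs k Center.inf i ω - R.h0 k Center.inf ω ≤ -(A.γ * m * A.ε * R.δp k ω ^ 2) ∧
    0 < R.us A k Center.inf i ω ∧ R.us A k Center.inf i ω ≤ R.hmax A k ω

/-- The trial point `i` around the `ε`-infeasible incumbent improves the estimated violation. -/
def ImprovesAt (k : ℕ) (i : Fin (R.N k)) (ω : Ω) : Prop :=
  R.Evaluated P k Center.inf i ω ∧
    R.hs k Center.inf i ω - R.h0 k Center.inf ω ≤ -(A.γ * m * A.ε * R.δp k ω ^ 2)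

/-- Poll size after a dominating or improving iteration. -/
noncomputable def enlarged (k : ℕ) (ω : Ω) : ℝ :=
  min ((A.τ : ℝ)⁻¹ * R.δp k ω) (((A.τ : ℝ) ^ A.zhat)⁻¹)

/-- Update at the end of iteration `k`. -/
def Step (k : ℕ) (ω : Ω) : Prop :=
  -- `f`-Dominating
  (∃ a i, R.FDomAt P A k a i ω ∧ R.x (k + 1) Center.inf ω = R.x k Center.inf ω ∧
    R.x (k + 1) Center.feas ω = R.trial k a i ω ∧ R.δp (k + 1) ω = R.enlarged A k ω ∧
    R.flag (k + 1) ω = true) ∨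
  -- `h`-Dominating
  ((¬ ∃ a i, R.FDomAt P A k a i ω) ∧
    ∃ i, R.HDomAt P A k i ω ∧ R.x (k + 1) Center.inf ω = R.trial k Center.inf i ω ∧
      R.x (k + 1) Center.feas ω = R.x k Center.feas ω ∧ R.δp (k + 1) ω = R.enlarged A k ω ∧
      R.flag (k + 1) ω = R.flag k ω) ∨
  -- Improving
  ((¬ ∃ a i, R.FDomAt P A k a i ω) ∧ (¬ ∃ i, R.HDomAt P A k i ω) ∧
    ∃ i, R.ImprovesAt P A k i ω ∧
      (∀ i', R.ImprovesAt P A k i' ω → R.us A k Center.inf i ω ≤ R.us A k Center.inf i' ω) ∧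
      R.x (k + 1) Center.inf ω = R.trial k Center.inf i ω ∧
      R.x (k + 1) Center.feas ω = R.x k Center.feas ω ∧ R.δp (k + 1) ω = R.enlarged A k ω ∧
      R.flag (k + 1) ω = R.flag k ω) ∨
  -- Unsuccessful
  ((¬ ∃ a i, R.FDomAt P A k a i ω) ∧ (¬ ∃ i, R.HDomAt P A k i ω) ∧
    (¬ ∃ i, R.ImprovesAt P A k i ω) ∧
      (∀ a, R.x (k + 1) a ω = R.x k a ω) ∧ R.δp (k + 1) ω = A.τ * R.δp k ω ∧
      R.flag (k + 1) ω = R.flag k ω)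

/-- The polling directions around the incumbent `a` at iteration `k` are admissible: nonzero,
positively spanning, leading to mesh points, and inside the frame, whose size is `b` times the
poll size, with `b = max_j ‖col j‖_∞`. -/
def PollOK (k : ℕ) (a : Center) (ω : Ω) : Prop :=
  PositivelySpans (fun i => R.dir k a i ω) ∧
    ∀ i, R.dir k a i ω ≠ 0 ∧ R.trial k a i ω ∈ R.mesh A k ω ∧
      R.δm k ω * ‖R.dir k a i ω‖ ≤ R.δp k ω * ⨆ j, ‖A.col j‖

/-- `R` is a run of the algorithm on the problem `P` with initialization `A`. -/
structure IsRun : Prop where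
  x0_mem : A.x0 ∈ P.X
  init_x : ∀ a ω, R.x 0 a ω = A.x0
  init_flag : ∀ ω, R.flag 0 ω = false
  init_δp : ∀ ω, R.δp 0 ω = A.δ0
  poll : ∀ k a ω, R.Avail k a ω → R.PollOK A k a ω
  step : ∀ k ω, R.Step P A k ω

/-- The random time at which a first `ε`-feasible solution is available:
`inf {k : some ε-feasible iterate of index ≤ k differs from x0}`. -/
noncomputable def T (ω : Ω) : ℕ∞ :=
  sInf ((fun k : ℕ => (k : ℕ∞)) '' {k | ∃ l ≤ k, R.x l Center.feas ω ≠ A.x0})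

/-! ### Probabilistic assumptions -/

/-- The σ-algebra generated by the estimates of the iterations `0, …, k - 1`. -/
abbrev past (k : ℕ) : MeasurableSpace Ω :=
  ⨆ (l : ℕ) (_ : l < k) (a : Center),
    (MeasurableSpace.comap (R.F0 l a) inferInstance ⊔
      ⨆ i, MeasurableSpace.comap (R.Fs l a i) inferInstance) ⊔
    ((⨆ j, MeasurableSpace.comap (R.C0 l a j) inferInstance) ⊔
      ⨆ i, ⨆ j, MeasurableSpace.comap (R.Cs l a i j) inferInstance)

/-- Measurability: the estimates are random variables, and what the algorithm knows when the poll
of iteration `k` starts is determined by the estimates of the previous iterations. -/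
structure IsAdapted [MeasurableSpace Ω] : Prop where
  meas_F0 : ∀ k a, Measurable (R.F0 k a)
  meas_Fs : ∀ k a i, Measurable (R.Fs k a i)
  meas_C0 : ∀ k a j, Measurable (R.C0 k a j)
  meas_Cs : ∀ k a i j, Measurable (R.Cs k a i j)
  x_past : ∀ k a, Measurable[R.past k] (R.x k a)
  flag_past : ∀ k, Measurable[R.past k] (R.flag k)
  δp_past : ∀ k, Measurable[R.past k] (R.δp k)
  dir_past : ∀ k a i, Measurable[R.past k] (R.dir k a i)

/-- Event that all estimates of `f` computed at iteration `k` are `ε`-accurate. -/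
def J (k : ℕ) : Set Ω :=
  {ω | (∀ a, R.Avail k a ω → |R.F0 k a ω - P.f (R.x k a ω)| ≤ A.ε * R.δp k ω ^ 2) ∧
    ∀ a i, R.Evaluated P k a i ω →
      |R.Fs k a i ω - P.f (R.trial k a i ω)| ≤ A.ε * R.δp k ω ^ 2}

/-- Event that all estimates of `c_j` computed at iteration `k` are `ε`-accurate. -/
def Ij (j : Fin m) (k : ℕ) : Set Ω :=
  {ω | (∀ a, R.Avail k a ω → |R.C0 k a j ω - P.c j (R.x k a ω)| ≤ A.ε * R.δp k ω ^ 2) ∧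
    ∀ a i, R.Evaluated P k a i ω →
      |R.Cs k a i j ω - P.c j (R.trial k a i ω)| ≤ A.ε * R.δp k ω ^ 2}

/-- Event that all bounds computed at iteration `k` are `ε`-reliable. -/
def I (k : ℕ) : Set Ω :=
  {ω | (∀ a, R.Avail k a ω →
      R.l0 A k a ω ≤ P.h (R.x k a ω) ∧ P.h (R.x k a ω) ≤ R.u0 A k a ω) ∧
    ∀ a i, R.Evaluated P k a i ω →
      R.ls A k a i ω ≤ P.h (R.trial k a i ω) ∧ P.h (R.trial k a i ω) ≤ R.us A k a i ω}

open Classical in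
/-- Largest error, over the incumbents of iteration `k`, of the estimates `e` of the function
`g`. -/
noncomputable def err0 (g : Vec n → ℝ) (e : ℕ → Center → Ω → ℝ) (k : ℕ) (ω : Ω) : ℝ :=
  ⨆ a : Center, if R.Avail k a ω then |e k a ω - g (R.x k a ω)| else 0

open Classical in
/-- Largest error, over the evaluated trial points of iteration `k`, of the estimates `e` of the
function `g` (zero if there is no such point). -/
noncomputable def errs (g : Vec n → ℝ) (e : (k : ℕ) → Center → Fin (R.N k) → Ω → ℝ)
    (k : ℕ) (ω : Ω) : ℝ :=
  ⨆ q : Center × Fin (R.N k),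
    if R.Evaluated P k q.1 q.2 ω then |e k q.1 q.2 ω - g (R.trial k q.1 q.2 ω)| else 0

/-- `P(E | past k) ≥ a` almost surely. -/
def CondProbGE [MeasurableSpace Ω] (μ : Measure Ω) (E : Set Ω) (k : ℕ) (a : ℝ) : Prop :=
  ∀ᵐ ω ∂μ, a ≤ (μ[E.indicator (fun _ => (1 : ℝ)) | R.past k]) ω

/-- `Y` is integrable and `E[Y | past k] ≤ B` almost surely. -/
def CondExpLE [MeasurableSpace Ω] (μ : Measure Ω) (Y : Ω → ℝ) (k : ℕ) (B : Ω → ℝ) : Prop :=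
  Integrable Y μ ∧ ∀ᵐ ω ∂μ, (μ[Y | R.past k]) ω ≤ B ω

/-- Accuracy, reliability and variance conditions on estimates and bounds. -/
structure EstimatesOK [MeasurableSpace Ω] (μ : Measure Ω) (α β : ℝ) : Prop where
  f_acc : ∀ k, R.CondProbGE μ (R.J P A k) k β
  f_var_s : ∀ k, R.CondExpLE μ (fun ω => R.errs P P.f R.Fs k ω ^ 2) k
    (fun ω => A.ε ^ 2 * (1 - Real.sqrt β) * R.δp k ω ^ 4)
  f_var_0 : ∀ k, R.CondExpLE μ (fun ω => R.err0 P.f R.F0 k ω ^ 2) k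
    (fun ω => A.ε ^ 2 * (1 - Real.sqrt β) * R.δp k ω ^ 4)
  c_acc : ∀ j k, R.CondProbGE μ (R.Ij P A j k) k (α ^ (1 / (m : ℝ)))
  c_var_s : ∀ j k, R.CondExpLE μ
    (fun ω => R.errs P (P.c j) (fun k a i => R.Cs k a i j) k ω ^ 2) k
    (fun ω => A.ε ^ 2 * (1 - α ^ (1 / (2 * (m : ℝ)))) * R.δp k ω ^ 4)
  c_var_0 : ∀ j k, R.CondExpLE μ
    (fun ω => R.err0 (P.c j) (fun k a => R.C0 k a j) k ω ^ 2) k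
    (fun ω => A.ε ^ 2 * (1 - α ^ (1 / (2 * (m : ℝ)))) * R.δp k ω ^ 4)
  bounds_rel : ∀ k, R.CondProbGE μ (R.I P A k) k α
  h_mean_s : ∀ k, R.CondExpLE μ (fun ω => R.errs P P.h R.hs k ω) k
    (fun ω => m * A.ε * Real.sqrt (1 - α) * R.δp k ω ^ 2)
  h_mean_0 : ∀ k, R.CondExpLE μ (fun ω => R.err0 P.h R.h0 k ω) k
    (fun ω => m * A.ε * Real.sqrt (1 - α) * R.δp k ω ^ 2)

end StoMADSRun

/-! ### Tangent cones -/

theorem isOpen_hypertangentCone {n : ℕ} (O : Set (Vec n)) (x : Vec n) :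
    IsOpen (hypertangentCone O x) := by
  rw [Metric.isOpen_iff]
  rintro v ⟨ε, hε, h⟩
  refine ⟨ε / 2, half_pos hε, fun v' hv' => ⟨ε / 2, half_pos hε, ?_⟩⟩
  intro y hy w hw t ht htε
  refine h y ⟨hy.1, Metric.ball_subset_ball (by linarith) hy.2⟩ w ?_ t ht (by linarith)
  rw [Metric.mem_ball] at *
  linarith [dist_triangle w v' v]

/-- Adding a positive multiple of a hypertangent vector to a Clarke tangent vector gives a
hypertangent vector. -/
theorem add_smul_mem_hypertangentCone {n : ℕ} {O : Set (Vec n)} {x u v : Vec n}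
    (hv : v ∈ clarkeTangentCone O x) (hu : u ∈ hypertangentCone O x) {r : ℝ} (hr : 0 < r) :
    v + r • u ∈ hypertangentCone O x := by
  by_contra hcon
  have hex : ∀ k : ℕ, ∃ (y w : Vec n) (t : ℝ), y ∈ O ∧ dist y x < 1 / ((k : ℝ) + 1) ∧
      dist w (v + r • u) < 1 / ((k : ℝ) + 1) ∧ 0 < t ∧ t < 1 / ((k : ℝ) + 1) ∧
      y + t • w ∉ O := by
    intro k
    by_contra hk
    push Not at hk
    exact hcon ⟨1 / ((k : ℝ) + 1), Nat.one_div_pos_of_nat,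
      fun y hy w hw t ht ht' => hk y w t hy.1 hy.2 hw ht ht'⟩
  choose y w t hyO hyx hw ht ht' hnot using hex
  have h0 : Tendsto (fun k : ℕ => 1 / ((k : ℝ) + 1)) atTop (𝓝 0) :=
    tendsto_one_div_add_atTop_nhds_zero_nat
  have hy : Tendsto y atTop (𝓝 x) := tendsto_iff_dist_tendsto_zero.2
    (squeeze_zero (fun _ => dist_nonneg) (fun k => (hyx k).le) h0)
  have hwl : Tendsto w atTop (𝓝 (v + r • u)) := tendsto_iff_dist_tendsto_zero.2
    (squeeze_zero (fun _ => dist_nonneg) (fun k => (hw k).le) h0)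
  have htl : Tendsto t atTop (𝓝 0) := squeeze_zero (fun k => (ht k).le) (fun k => (ht' k).le) h0
  obtain ⟨v', hv'l, hv'⟩ := hv y t hyO hy ht htl
  obtain ⟨ε, hε, hball⟩ := hu
  have h1 : Tendsto (fun k => y k + t k • v' k) atTop (𝓝 x) := by
    simpa using hy.add (htl.smul hv'l)
  have h2 : Tendsto (fun k => r⁻¹ • (w k - v' k)) atTop (𝓝 u) := by
    have := (hwl.sub hv'l).const_smul r⁻¹
    simpa [smul_smul, inv_mul_cancel₀ hr.ne'] using this
  have h3 : Tendsto (fun k => r * t k) atTop (𝓝 0) := by simpa using htl.const_mul r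
  obtain ⟨k, hk1, hk2, hk3⟩ := ((h1.eventually (Metric.ball_mem_nhds x hε)).and
    ((h2.eventually (Metric.ball_mem_nhds u hε)).and (h3.eventually (gt_mem_nhds hε)))).exists
  refine hnot k ?_
  have := hball _ ⟨hv' k, hk1⟩ _ hk2 (r * t k) (mul_pos hr (ht k)) hk3
  convert this using 1
  rw [smul_smul, mul_comm r, mul_assoc, mul_inv_cancel₀ hr.ne', mul_one, smul_sub]
  abel

/-! ### Stationarity of refined points -/

theorem clarkeDeriv_nonneg_of_forall {n : ℕ} {X : Set (Vec n)} {g : Vec n → ℝ} {x v : Vec n}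
    (h : ∀ ζ : ℝ, 0 < ζ → ∃ (F : Filter ℕ) (y : ℕ → Vec n) (t : ℕ → ℝ), F.NeBot ∧
      Tendsto y F (𝓝 x) ∧ Tendsto t F (𝓝 0) ∧ ∀ᶠ k in F, 0 < t k ∧ y k ∈ X ∧
        y k + t k • v ∈ X ∧ -ζ ≤ (g (y k + t k • v) - g (y k)) / t k) :
    0 ≤ clarkeDeriv X g x v := by
  have key : ∀ ζ : ℝ, 0 < ζ → ((-ζ : ℝ) : EReal) ≤ clarkeDeriv X g x v := by
    intro ζ hζ
    obtain ⟨F, y, t, hF, hy, ht, hev⟩ := h ζ hζ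
    refine le_limsup_of_frequently_le' ?_
    have hT : Tendsto (fun k => (y k, t k)) F
        ((𝓝 x ×ˢ 𝓝[>] (0 : ℝ)) ⊓ 𝓟 {q | q.1 ∈ X ∧ q.1 + q.2 • v ∈ X}) := by
      refine tendsto_inf.2 ⟨hy.prodMk (tendsto_nhdsWithin_iff.2 ⟨ht, ?_⟩),
        tendsto_principal.2 ?_⟩
      · exact hev.mono fun k hk => hk.1
      · exact hev.mono fun k hk => ⟨hk.2.1, hk.2.2.1⟩
    refine hT.frequently (Eventually.frequently ?_)
    exact hev.mono fun k hk => EReal.coe_le_coe_iff.2 hk.2.2.2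
  by_contra hneg
  push Not at hneg
  obtain ⟨q, hq1, hq2⟩ := EReal.lt_iff_exists_real_btwn.1 hneg
  have hq0 : q < 0 := by exact_mod_cast hq2
  have := key (-q) (by linarith)
  rw [neg_neg] at this
  exact absurd hq1 (not_lt.2 this)

theorem tendsto_zero_of_tendsto_min_sq {ι : Type*} {F : Filter ι} {δ : ι → ℝ}
    (hpos : ∀ i, 0 < δ i) (h : Tendsto (fun i => min (δ i) (δ i ^ 2)) F (𝓝 0)) :
    Tendsto δ F (𝓝 0) := by
  rw [Metric.tendsto_nhds]
  intro η hη
  have hm : 0 < min η (η ^ 2) := lt_min hη (by positivity)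
  filter_upwards [h.eventually (gt_mem_nhds hm)] with i hi
  rw [Real.dist_eq, sub_zero, abs_of_pos (hpos i)]
  by_contra hle
  push Not at hle
  exact absurd hi (not_lt.2 (min_le_min hle (pow_le_pow_left₀ hη.le hle 2)))

/-- A refined point has nonnegative Clarke derivatives along the Clarke tangent cone of `O`, if the
refining directions are dense in the hypertangent cone of `O` and small steps along hypertangent
directions from the points of the refining subsequence stay in `X`. -/
theorem clarkeDeriv_nonneg_of_refining {n : ℕ} {X O : Set (Vec n)} {g : Vec n → ℝ}
    (hg : LocallyLipschitzOn X g) {x : ℕ → Vec n} {δm δp : ℕ → ℝ} {D : ℕ → Set (Vec n)}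
    {K : Set ℕ} {xhat : Vec n} (href : IsRefining x δm K xhat) (hX : xhat ∈ X)
    (hpos : ∀ k, 0 < δp k) (hδm : ∀ k, δm k = min (δp k) (δp k ^ 2)) {b dmin : ℝ}
    (hb : ∀ᶠ k in atTop ⊓ 𝓟 K, ∀ d ∈ D k, δm k * ‖d‖ ≤ δp k * b) (hdmin : 0 < dmin)
    (hd : ∀ᶠ k in atTop ⊓ 𝓟 K, ∀ d ∈ D k, dmin ≤ δp k * ‖d‖)
    (hψ : PsiLimNonpos X g x δm δp D K) (hx : ∀ᶠ k in atTop ⊓ 𝓟 K, x k ∈ X)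
    (hcone : ∀ u ∈ hypertangentCone O xhat, ∃ ε : ℝ, 0 < ε ∧ ∀ᶠ k in atTop ⊓ 𝓟 K,
      ∀ w ∈ Metric.ball u ε, ∀ t : ℝ, 0 < t → t < ε → x k + t • w ∈ X)
    (hne : (hypertangentCone O xhat).Nonempty)
    (hdense : DirectionsDenseIn (refiningDirections D K) (hypertangentCone O xhat)) :
    ∀ v ∈ clarkeTangentCone O xhat, 0 ≤ clarkeDeriv X g xhat v := by
  intro v hv
  obtain ⟨L, s, hs, hL⟩ := hg hX
  obtain ⟨u, hu⟩ := hne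
  obtain ⟨ε, hε, hεK⟩ := hcone u hu
  refine clarkeDeriv_nonneg_of_forall fun ζ hζ => ?_
  have hC : 0 < 2 * ((L : ℝ) * (‖u‖ + ε) + 1) := by positivity
  set l : ℝ := ζ / (2 * ((L : ℝ) * (‖u‖ + ε) + 1)) with hl
  have hl0 : 0 < l := div_pos hζ hC
  have hlζ : (L : ℝ) * (l * (‖u‖ + ε)) ≤ ζ / 2 := by
    have : l * (2 * ((L : ℝ) * (‖u‖ + ε) + 1)) = ζ := div_mul_cancel₀ _ hC.ne'
    nlinarith
  have hvu := add_smul_mem_hypertangentCone hv hu hl0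
  obtain ⟨z, ⟨hz1, hz2⟩, r, hr, ρ, hρ, rfl⟩ := mem_closure_iff.1 (hdense hvu) _
    ((isOpen_hypertangentCone O xhat).inter Metric.isOpen_ball)
    ⟨hvu, Metric.mem_ball_self (mul_pos hl0 hε)⟩
  obtain ⟨M, hMK, hMinf, d, hdD, hdl⟩ := hρ
  have hF : (atTop ⊓ 𝓟 M).NeBot := frequently_mem_iff_neBot.1 (Nat.frequently_atTop_iff_infinite.2 hMinf)
  have hle : atTop ⊓ 𝓟 M ≤ atTop ⊓ 𝓟 K := inf_le_inf_left _ (principal_mono.2 hMK)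
  have hM : ∀ᶠ k in atTop ⊓ 𝓟 M, k ∈ M := mem_inf_of_right (mem_principal_self M)
  have hxl := href.2.1.mono_left hle
  have hδml := href.2.2.mono_left hle
  have hδpl : Tendsto δp (atTop ⊓ 𝓟 M) (𝓝 0) :=
    tendsto_zero_of_tendsto_min_sq hpos (hδml.congr hδm)
  have hδm0 : ∀ k, 0 < δm k := fun k => by
    rw [hδm]; exact lt_min (hpos k) (by have := hpos k; positivity)
  set T : ℕ → ℝ := fun k => δm k * ‖d k‖ / r with hTdef
  set Z : ℕ → Vec n := fun k => r • (‖d k‖⁻¹ • d k) with hZdef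
  have hTl : Tendsto T (atTop ⊓ 𝓟 M) (𝓝 0) := by
    refine squeeze_zero' (Eventually.of_forall fun k => ?_) ?_
      (by simpa using (hδpl.mul_const b).div_const r)
    · have := hδm0 k; positivity
    · filter_upwards [hle hb, hM] with k hk hkM
      exact div_le_div_of_nonneg_right (hk _ (hdD k hkM)) hr.le
  have hZl : Tendsto Z (atTop ⊓ 𝓟 M) (𝓝 (r • ρ)) := hdl.const_smul r
  have hZvl : Tendsto (fun k => Z k - v) (atTop ⊓ 𝓟 M) (𝓝 (r • ρ - v)) := hZl.sub_const v
  have hyl : Tendsto (fun k => x k + T k • (Z k - v)) (atTop ⊓ 𝓟 M) (𝓝 xhat) := by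
    simpa using hxl.add (hTl.smul hZvl)
  have hWl : Tendsto (fun k => l⁻¹ • (Z k - v)) (atTop ⊓ 𝓟 M) (𝓝 (l⁻¹ • (r • ρ - v))) :=
    hZvl.const_smul _
  have hWball : l⁻¹ • (r • ρ - v) ∈ Metric.ball u ε := by
    rw [Metric.mem_ball, dist_eq_norm] at hz2 ⊢
    have : l⁻¹ • (r • ρ - v) - u = l⁻¹ • (r • ρ - (v + l • u)) := by
      rw [← sub_sub, smul_sub _ (r • ρ - v), smul_smul, inv_mul_cancel₀ hl0.ne', one_smul]
    rw [this, norm_smul, norm_inv, Real.norm_of_nonneg hl0.le, inv_mul_lt_iff₀ hl0]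
    exact hz2
  obtain ⟨ε', hε', hεK'⟩ := hcone _ hz1
  have hlT : Tendsto (fun k => l * T k) (atTop ⊓ 𝓟 M) (𝓝 0) := by simpa using hTl.const_mul l
  obtain ⟨S, hSo, hxS, hSs⟩ := mem_nhdsWithin.1 hs
  refine ⟨atTop ⊓ 𝓟 M, fun k => x k + T k • (Z k - v), T, hF, hyl, hTl, ?_⟩
  have hη : 0 < ζ / 2 * dmin / r := by positivity
  filter_upwards [hM, hle hd, hle hx, hle hεK, hle hεK', hle (hψ _ hη),
    hδpl.eventually (gt_mem_nhds one_pos), hWl.eventually (Metric.isOpen_ball.mem_nhds hWball),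
    hZl.eventually (Metric.ball_mem_nhds _ hε'), hTl.eventually (gt_mem_nhds hε'),
    hlT.eventually (gt_mem_nhds hε), hxl.eventually (hSo.mem_nhds hxS),
    hyl.eventually (hSo.mem_nhds hxS)]
    with k hkM hkd hkx hkε hkε' hkψ hk1 hkW hkZ hkT hklT hkS hkyS
  have hdk := hkd _ (hdD k hkM)
  have hdpos : 0 < ‖d k‖ := by
    rcases (norm_nonneg (d k)).eq_or_lt with h | h
    · rw [← h, mul_zero] at hdk; linarith
    · exact h
  have hTpos : 0 < T k := div_pos (mul_pos (hδm0 k) hdpos) hr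
  have hTZ : T k • Z k = δm k • d k := by
    simp only [hTdef, hZdef, smul_smul]
    congr 1
    field_simp
  have htr : x k + T k • (Z k - v) + T k • v = x k + δm k • d k := by
    rw [add_assoc, ← smul_add, sub_add_cancel, hTZ]
  have htrX : x k + δm k • d k ∈ X := by
    rw [← hTZ]; exact hkε' _ hkZ _ hTpos hkT
  have hyX : x k + T k • (Z k - v) ∈ X := by
    have := hkε _ hkW (l * T k) (mul_pos hl0 hTpos) hklT
    rwa [smul_smul, mul_comm l, mul_assoc, mul_inv_cancel₀ hl0.ne', mul_one] at this
  refine ⟨hTpos, hyX, by rw [htr]; exact htrX, ?_⟩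
  rw [htr, le_div_iff₀ hTpos]
  have h1 : g (x k) - g (x k + δm k • d k) ≤ ζ / 2 * T k := by
    have h := hkψ _ (hdD k hkM) htrX
    rw [div_le_iff₀ (hpos k)] at h
    refine h.trans ?_
    have hmk : δm k = δp k ^ 2 := by
      rw [hδm, min_eq_right]; nlinarith [hpos k]
    have : dmin * δp k ≤ δm k * ‖d k‖ := by rw [hmk]; nlinarith [hpos k]
    simp only [hTdef]
    rw [div_mul_eq_mul_div, ← mul_div_assoc]
    refine div_le_div_of_nonneg_right ?_ hr.le
    nlinarith
  have h2 : g (x k + T k • (Z k - v)) - g (x k) ≤ ζ / 2 * T k := by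
    have h := hL.dist_le_mul _ (hSs ⟨hkyS, hyX⟩) _ (hSs ⟨hkS, hkx⟩)
    rw [dist_eq_norm, dist_eq_norm, add_sub_cancel_left, norm_smul,
      Real.norm_of_nonneg hTpos.le] at h
    have hn : ‖Z k - v‖ ≤ l * (‖u‖ + ε) := by
      have hW : ‖l⁻¹ • (Z k - v)‖ ≤ ‖u‖ + ε := by
        rw [dist_eq_norm] at hkW
        linarith [norm_le_insert' (l⁻¹ • (Z k - v)) u]
      rwa [norm_smul, norm_inv, Real.norm_of_nonneg hl0.le, inv_mul_le_iff₀ hl0] at hW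
    calc g (x k + T k • (Z k - v)) - g (x k) ≤ _ := le_abs_self _
      _ ≤ L * (T k * ‖Z k - v‖) := h
      _ ≤ L * (T k * (l * (‖u‖ + ε))) := by gcongr
      _ = L * (l * (‖u‖ + ε)) * T k := by ring
      _ ≤ _ := by gcongr
  linarith

instance : Finite Center :=
  Finite.of_injective (fun a : Center => match a with | .inf => false | .feas => true) (by
    intro a b; cases a <;> cases b <;> simp)

namespace Params

variable {n : ℕ} (A : Params n)

theorem τ_cast_pos : (0 : ℝ) < A.τ := by exact_mod_cast A.τ_pos

theorem τ_cast_lt_one : (A.τ : ℝ) < 1 := by exact_mod_cast A.τ_lt_one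

end Params

theorem Problem.h_nonneg {n m : ℕ} (P : Problem n m) (x : Vec n) : 0 ≤ P.h x :=
  Finset.sum_nonneg fun _ _ => le_max_right _ _

theorem Problem.mem_feasible_of_h_eq_zero {n m : ℕ} {P : Problem n m} {x : Vec n} (hx : x ∈ P.X)
    (h : P.h x = 0) : x ∈ P.feasible := by
  refine ⟨hx, fun j => ?_⟩
  have := (Finset.sum_eq_zero_iff_of_nonneg (fun _ _ => le_max_right _ _)).1 h j (Finset.mem_univ j)
  exact (le_max_left _ _).trans this.le

namespace StoMADSRun

variable {n m : ℕ} {Ω : Type*} {P : Problem n m} {A : Params n} {R : StoMADSRun n m Ω}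

/-! ### Poll size, flag and incumbents -/

theorem avail_inf (k : ℕ) (ω : Ω) : R.Avail k Center.inf ω := Or.inl rfl

theorem IsRun.δp_succ (h : R.IsRun P A) (k : ℕ) (ω : Ω) :
    R.δp (k + 1) ω = R.enlarged A k ω ∨ R.δp (k + 1) ω = A.τ * R.δp k ω := by
  rcases h.step k ω with ⟨_, _, _, _, _, h, _⟩ | ⟨_, _, _, _, _, h, _⟩ | ⟨_, _, _, _, _, _, _, h, _⟩ |
    ⟨_, _, _, _, h, _⟩
  exacts [Or.inl h, Or.inl h, Or.inl h, Or.inr h]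

theorem IsRun.le_δp (h : R.IsRun P A) (k : ℕ) (ω : Ω) :
    (A.τ : ℝ) ^ k * min A.δ0 ((A.τ : ℝ) ^ A.zhat)⁻¹ ≤ R.δp k ω := by
  have hτ := A.τ_cast_pos
  have hm : 0 < min A.δ0 ((A.τ : ℝ) ^ A.zhat)⁻¹ := lt_min A.δ0_pos (by positivity)
  induction k with
  | zero => rw [h.init_δp, pow_zero, one_mul]; exact min_le_left _ _
  | succ k ih =>
    rcases h.δp_succ k ω with e | e <;> rw [e]
    · refine le_min ?_ ?_
      · calc _ ≤ (A.τ : ℝ) ^ k * min A.δ0 ((A.τ : ℝ) ^ A.zhat)⁻¹ := by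
              gcongr ?_ * _
              exact pow_le_pow_of_le_one hτ.le A.τ_cast_lt_one.le k.le_succ
          _ ≤ 1 * R.δp k ω := by rwa [one_mul]
          _ ≤ _ := by
              gcongr
              · exact (by positivity : (0 : ℝ) ≤ _).trans ih
              · exact (one_le_inv₀ hτ).2 A.τ_cast_lt_one.le
      · refine le_trans (mul_le_of_le_one_left hm.le ?_) (min_le_right _ _)
        exact pow_le_one₀ hτ.le A.τ_cast_lt_one.le
    · rw [pow_succ', mul_assoc]
      exact mul_le_mul_of_nonneg_left ih hτ.le

theorem IsRun.δp_pos (h : R.IsRun P A) (k : ℕ) (ω : Ω) : 0 < R.δp k ω := by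
  have hτ := A.τ_cast_pos
  exact (mul_pos (pow_pos hτ k) (lt_min A.δ0_pos (by positivity))).trans_le (h.le_δp k ω)

theorem IsRun.δp_le (h : R.IsRun P A) (k : ℕ) (ω : Ω) :
    R.δp k ω ≤ max A.δ0 ((A.τ : ℝ) ^ A.zhat)⁻¹ := by
  induction k with
  | zero => rw [h.init_δp]; exact le_max_left _ _
  | succ k ih =>
    rcases h.δp_succ k ω with e | e <;> rw [e]
    · exact (min_le_right _ _).trans (le_max_right _ _)
    · exact (mul_le_of_le_one_left (h.δp_pos k ω).le A.τ_cast_lt_one.le).trans ih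

theorem IsRun.enlarged_sq_le (h : R.IsRun P A) (k : ℕ) (ω : Ω) :
    R.enlarged A k ω ^ 2 ≤ ((A.τ : ℝ) ^ 2)⁻¹ * R.δp k ω ^ 2 := by
  have hτ := A.τ_cast_pos
  rw [← inv_pow, ← mul_pow]
  exact pow_le_pow_left₀ (le_min (mul_nonneg (inv_nonneg.2 hτ.le) (h.δp_pos k ω).le)
    (by positivity)) (min_le_left _ _) 2

theorem IsRun.flag_succ (h : R.IsRun P A) {k : ℕ} {ω : Ω} (hk : R.flag k ω = true) :
    R.flag (k + 1) ω = true := by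
  rcases h.step k ω with ⟨_, _, _, _, _, _, h⟩ | ⟨_, _, _, _, _, _, h⟩ |
    ⟨_, _, _, _, _, _, _, _, h⟩ | ⟨_, _, _, _, _, h⟩
  exacts [h, h.trans hk, h.trans hk, h.trans hk]

theorem IsRun.flag_mono (h : R.IsRun P A) {k l : ℕ} {ω : Ω} (hkl : k ≤ l)
    (hk : R.flag k ω = true) : R.flag l ω = true := by
  induction l, hkl using Nat.le_induction with
  | base => exact hk
  | succ l _ ih => exact h.flag_succ ih

theorem IsRun.flag_of_feas_ne (h : R.IsRun P A) {k : ℕ} {ω : Ω}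
    (hk : R.x k Center.feas ω ≠ A.x0) : R.flag k ω = true := by
  induction k with
  | zero => exact absurd (h.init_x _ ω) hk
  | succ k ih =>
    rcases h.step k ω with ⟨_, _, _, _, _, _, h'⟩ | ⟨_, _, _, _, e, _, h'⟩ |
      ⟨_, _, _, _, _, _, e, _, h'⟩ | ⟨_, _, _, e, _, h'⟩
    · exact h'
    · exact h'.trans (ih (e ▸ hk))
    · exact h'.trans (ih (e ▸ hk))
    · exact h'.trans (ih (e _ ▸ hk))

theorem IsRun.flag_of_T_le (h : R.IsRun P A) {k : ℕ} {ω : Ω} (hT : R.T A ω < ⊤)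
    (hk : (R.T A ω).toNat ≤ k) : R.flag k ω = true := by
  have hne : ((fun k : ℕ => (k : ℕ∞)) ''
      {k | ∃ l ≤ k, R.x l Center.feas ω ≠ A.x0}).Nonempty := by
    by_contra hcon
    rw [not_nonempty_iff_eq_empty] at hcon
    rw [T, hcon, sInf_empty] at hT
    exact lt_irrefl _ hT
  obtain ⟨N, ⟨l, hl, hlx⟩, hN⟩ := csInf_mem hne
  have hN' : (R.T A ω).toNat = N := by
    have : R.T A ω = (N : ℕ∞) := hN.symm
    rw [this, ENat.toNat_natCast]
  exact h.flag_mono (hl.trans (hN' ▸ hk)) (h.flag_of_feas_ne hlx)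

/-! ### Estimation errors -/

theorem abs_le_err0 {g : Vec n → ℝ} {e : ℕ → Center → Ω → ℝ} {k : ℕ} {a : Center} {ω : Ω}
    (ha : R.Avail k a ω) : |e k a ω - g (R.x k a ω)| ≤ R.err0 g e k ω := by
  have := le_ciSup (Set.finite_range (fun a : Center =>
    open Classical in if R.Avail k a ω then |e k a ω - g (R.x k a ω)| else 0)).bddAbove a
  rwa [if_pos ha] at this

theorem abs_le_errs {g : Vec n → ℝ} {e : (k : ℕ) → Center → Fin (R.N k) → Ω → ℝ} {k : ℕ}
    {a : Center} {i : Fin (R.N k)} {ω : Ω} (ha : R.Evaluated P k a i ω) :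
    |e k a i ω - g (R.trial k a i ω)| ≤ R.errs P g e k ω := by
  have := le_ciSup (Set.finite_range (fun q : Center × Fin (R.N k) =>
    open Classical in
    if R.Evaluated P k q.1 q.2 ω then |e k q.1 q.2 ω - g (R.trial k q.1 q.2 ω)| else 0)).bddAbove
    (a, i)
  rwa [if_pos ha] at this

theorem err0_nonneg {g : Vec n → ℝ} {e : ℕ → Center → Ω → ℝ} {k : ℕ} {ω : Ω} :
    0 ≤ R.err0 g e k ω :=
  Real.iSup_nonneg fun _ => by split_ifs <;> positivity

theorem errs_nonneg {g : Vec n → ℝ} {e : (k : ℕ) → Center → Fin (R.N k) → Ω → ℝ} {k : ℕ}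
    {ω : Ω} : 0 ≤ R.errs P g e k ω :=
  Real.iSup_nonneg fun _ => by split_ifs <;> positivity

/-! ### A potential that decreases up to estimation errors -/

/-- Weighted sum of the violation at the infeasible incumbent, of the objective at the feasible
incumbent (replaced by `M` as long as there is none) and of the squared poll size. -/
noncomputable def potential (P : Problem n m) (A : Params n) (R : StoMADSRun n m Ω) (ν M : ℝ)
    (k : ℕ) (ω : Ω) : ℝ :=
  ν * (P.h (R.x k Center.inf ω) / (m * A.ε) +
    (if R.flag k ω = true then P.f (R.x k Center.feas ω) else M) / A.ε) +
  (1 - ν) * R.δp k ω ^ 2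

/-- The total normalized error of the estimates of `h` and `f` at iteration `k`. -/
noncomputable def totalErr (P : Problem n m) (A : Params n) (R : StoMADSRun n m Ω)
    (k : ℕ) (ω : Ω) : ℝ :=
  (R.errs P P.h R.hs k ω + R.err0 P.h R.h0 k ω) / (m * A.ε) +
    (R.errs P P.f R.Fs k ω + R.err0 P.f R.F0 k ω) / A.ε

theorem sq_enlarged_sub_le {ν τ γ : ℝ} (hτ : 0 < τ) (hν0 : 0 < ν) (hν : ν < 1)
    (hγ : 2 < γ) (hνγ : 2 * ((τ ^ 2)⁻¹ - 1) / (γ - 2) ≤ ν / (1 - ν)) {D δ' : ℝ} (hD : 0 ≤ D)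
    (hδ' : δ' ≤ (τ ^ 2)⁻¹ * D) :
    (1 - ν) * δ' + (1 - ν) * (1 - τ ^ 2) * D ≤ (1 - ν) * D + ν * (γ * D) := by
  have h1 : 2 * ((τ ^ 2)⁻¹ - 1) * (1 - ν) ≤ ν * (γ - 2) :=
    (div_le_div_iff₀ (by linarith) (by linarith)).1 hνγ
  have h2 : 1 - τ ^ 2 ≤ (τ ^ 2)⁻¹ - 1 := by
    have hp : (0 : ℝ) < τ ^ 2 := by positivity
    have : τ ^ 2 * (τ ^ 2)⁻¹ = 1 := mul_inv_cancel₀ hp.ne'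
    have hi : 0 < (τ ^ 2)⁻¹ := inv_pos.2 hp
    nlinarith [sq_nonneg (τ ^ 2 - 1)]
  have hi : 0 ≤ 1 - ν := by linarith
  have h3 : (1 - ν) * δ' ≤ (1 - ν) * ((τ ^ 2)⁻¹ * D) := mul_le_mul_of_nonneg_left hδ' hi
  have h4 : (1 - ν) * (1 - τ ^ 2) * D ≤ (1 - ν) * ((τ ^ 2)⁻¹ - 1) * D := by gcongr
  have h5 := mul_le_mul_of_nonneg_right h1 hD
  have h6 : 0 ≤ ν * D := by positivity
  linarith

theorem div_le_of_estimates {e' e g' g s r c γ D : ℝ} (hc : 0 < c) (h' : |e' - g'| ≤ s)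
    (h : |e - g| ≤ r) (hd : e' - e ≤ -(γ * c * D)) :
    g' / c ≤ g / c - γ * D + (s + r) / c := by
  have := abs_le.1 h'
  have := abs_le.1 h
  have hle : g' / c ≤ (g - γ * c * D + (s + r)) / c := by
    gcongr
    linarith
  refine hle.trans_eq ?_
  field_simp

theorem totalErr_nonneg (k : ℕ) (ω : Ω) : 0 ≤ totalErr P A R k ω := by
  have := A.ε_pos
  have h1 := errs_nonneg (R := R) (P := P) (g := P.h) (e := R.hs) (k := k) (ω := ω)
  have h2 := err0_nonneg (R := R) (g := P.h) (e := R.h0) (k := k) (ω := ω)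
  have h3 := errs_nonneg (R := R) (P := P) (g := P.f) (e := R.Fs) (k := k) (ω := ω)
  have h4 := err0_nonneg (R := R) (g := P.f) (e := R.F0) (k := k) (ω := ω)
  unfold totalErr
  positivity

theorem IsRun.potential_succ_le (hm : 0 < m) (h : R.IsRun P A) {ν M : ℝ} (hν : ν ∈ Ioo (0 : ℝ) 1)
    (hνγ : 2 * (((A.τ : ℝ) ^ 2)⁻¹ - 1) / (A.γ - 2) ≤ ν / (1 - ν)) {k : ℕ} {ω : Ω}
    (hM : (1 - ν) * (((A.τ : ℝ) ^ 2)⁻¹ * R.δp k ω ^ 2) ≤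
      ν * ((M - P.f (R.x (k + 1) Center.feas ω)) / A.ε)) :
    potential P A R ν M (k + 1) ω + (1 - ν) * (1 - (A.τ : ℝ) ^ 2) * R.δp k ω ^ 2 ≤
      potential P A R ν M k ω + ν * totalErr P A R k ω := by
  have hε := A.ε_pos
  have hτ := A.τ_cast_pos
  have hmε : 0 < m * A.ε := by positivity
  have hD : 0 ≤ R.δp k ω ^ 2 := sq_nonneg _
  have hkey := sq_enlarged_sub_le hτ hν.1 hν.2 A.two_lt_γ hνγ hD (h.enlarged_sq_le k ω)
  have h1 := errs_nonneg (R := R) (P := P) (g := P.h) (e := R.hs) (k := k) (ω := ω)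
  have h2 := err0_nonneg (R := R) (g := P.h) (e := R.h0) (k := k) (ω := ω)
  have h3 := errs_nonneg (R := R) (P := P) (g := P.f) (e := R.Fs) (k := k) (ω := ω)
  have h4 := err0_nonneg (R := R) (g := P.f) (e := R.F0) (k := k) (ω := ω)
  have h5 : 0 ≤ (R.errs P P.h R.hs k ω + R.err0 P.h R.h0 k ω) / (m * A.ε) := by positivity
  have h6 : 0 ≤ (R.errs P P.f R.Fs k ω + R.err0 P.f R.F0 k ω) / A.ε := by positivity
  have himp : ∀ i, R.ImprovesAt P A k i ω → P.h (R.trial k Center.inf i ω) / (m * A.ε) ≤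
      P.h (R.x k Center.inf ω) / (m * A.ε) - A.γ * R.δp k ω ^ 2 +
        (R.errs P P.h R.hs k ω + R.err0 P.h R.h0 k ω) / (m * A.ε) := fun i hi =>
    div_le_of_estimates hmε (abs_le_errs hi.1) (abs_le_err0 (avail_inf k ω))
      (by rw [← mul_assoc]; exact hi.2)
  have hsucc : ∀ i, R.ImprovesAt P A k i ω → R.x (k + 1) Center.inf ω = R.trial k Center.inf i ω →
      R.x (k + 1) Center.feas ω = R.x k Center.feas ω → R.δp (k + 1) ω = R.enlarged A k ω →
      R.flag (k + 1) ω = R.flag k ω →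
      potential P A R ν M (k + 1) ω + (1 - ν) * (1 - (A.τ : ℝ) ^ 2) * R.δp k ω ^ 2 ≤
        potential P A R ν M k ω + ν * totalErr P A R k ω := by
    intro i hi e1 e2 e3 e4
    have hi := mul_le_mul_of_nonneg_left (himp i hi) hν.1.le
    have h6 := mul_nonneg hν.1.le h6
    unfold potential totalErr
    rw [e1, e2, e3, e4]
    linarith
  rcases h.step k ω with ⟨a, i, hf, e1, e2, e3, e4⟩ | ⟨_, i, hi, e1, e2, e3, e4⟩ |
    ⟨_, _, i, hi, _, e1, e2, e3, e4⟩ | ⟨_, _, _, e1, e3, e4⟩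
  · by_cases hflag : R.flag k ω = true
    · have hd := div_le_of_estimates hε (abs_le_errs (g := P.f) hf.1)
        (abs_le_err0 (g := P.f) (Or.inr hflag : R.Avail k Center.feas ω)) (hf.2.2 hflag)
      have hd := mul_le_mul_of_nonneg_left hd hν.1.le
      have h5 := mul_nonneg hν.1.le h5
      unfold potential totalErr
      rw [e1, e2, e3, e4, if_pos rfl, if_pos hflag]
      linarith
    · have h0 := mul_nonneg hν.1.le (totalErr_nonneg (P := P) (A := A) (R := R) k ω)
      have h7 : (1 - ν) * R.enlarged A k ω ^ 2 ≤ (1 - ν) * (((A.τ : ℝ) ^ 2)⁻¹ * R.δp k ω ^ 2) :=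
        mul_le_mul_of_nonneg_left (h.enlarged_sq_le k ω) (by linarith [hν.2])
      have h8 : (1 - ν) * (1 - (A.τ : ℝ) ^ 2) * R.δp k ω ^ 2 ≤ (1 - ν) * R.δp k ω ^ 2 := by
        gcongr
        exact mul_le_of_le_one_right (by linarith [hν.2]) (by linarith [sq_nonneg (A.τ : ℝ)])
      rw [sub_div] at hM
      unfold potential
      rw [e1, e3, e4, if_pos rfl, if_neg hflag]
      linarith
  · exact hsucc i ⟨hi.1, hi.2.2.1⟩ e1 e2 e3 e4
  · exact hsucc i hi e1 e2 e3 e4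
  · have h0 := mul_nonneg hν.1.le (totalErr_nonneg (P := P) (A := A) (R := R) k ω)
    unfold potential
    rw [e1, e1, e3, e4]
    linarith

theorem IsRun.sum_sq_le (hm : 0 < m) (h : R.IsRun P A) {ν κ M : ℝ} (hν : ν ∈ Ioo (0 : ℝ) 1)
    (hνγ : 2 * (((A.τ : ℝ) ^ 2)⁻¹ - 1) / (A.γ - 2) ≤ ν / (1 - ν)) {ω : Ω}
    (hM : ∀ k, (1 - ν) * (((A.τ : ℝ) ^ 2)⁻¹ * R.δp k ω ^ 2) ≤
      ν * ((M - P.f (R.x (k + 1) Center.feas ω)) / A.ε))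
    (hκ : ∀ k, κ ≤ P.f (R.x k Center.feas ω)) (N : ℕ) :
    (1 - ν) * (1 - (A.τ : ℝ) ^ 2) * ∑ k ∈ Finset.range N, R.δp k ω ^ 2 ≤
      potential P A R ν M 0 ω - ν * (κ / A.ε) + ν * ∑ k ∈ Finset.range N, totalErr P A R k ω := by
  have hε := A.ε_pos
  have hκM : κ ≤ M := by
    have h0 : 0 ≤ (1 - ν) * (((A.τ : ℝ) ^ 2)⁻¹ * R.δp 0 ω ^ 2) :=
      mul_nonneg (by linarith [hν.2]) (by positivity)
    have h1 := nonneg_of_mul_nonneg_right (h0.trans (hM 0)) hν.1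
    have h2 : 0 ≤ M - P.f (R.x 1 Center.feas ω) := by
      by_contra hcon
      exact absurd (div_neg_of_neg_of_pos (not_le.1 hcon) hε) (not_lt.2 h1)
    linarith [hκ 1]
  have hlow : ∀ k, ν * (κ / A.ε) ≤ potential P A R ν M k ω := by
    intro k
    have h1 : 0 ≤ P.h (R.x k Center.inf ω) / (m * A.ε) :=
      div_nonneg (P.h_nonneg _) (by positivity)
    have h2 : κ / A.ε ≤
        (if R.flag k ω = true then P.f (R.x k Center.feas ω) else M) / A.ε := by
      gcongr
      split_ifs
      exacts [hκ k, hκM]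
    have h3 : 0 ≤ (1 - ν) * R.δp k ω ^ 2 := mul_nonneg (by linarith [hν.2]) (sq_nonneg _)
    have h4 := mul_le_mul_of_nonneg_left (add_le_add h1 h2) hν.1.le
    unfold potential
    linarith
  have htel : ∀ N, potential P A R ν M N ω +
      (1 - ν) * (1 - (A.τ : ℝ) ^ 2) * ∑ k ∈ Finset.range N, R.δp k ω ^ 2 ≤
      potential P A R ν M 0 ω + ν * ∑ k ∈ Finset.range N, totalErr P A R k ω := by
    intro N
    induction N with
    | zero => simp
    | succ N ih =>
      rw [Finset.sum_range_succ, Finset.sum_range_succ, mul_add, mul_add]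
      linarith [h.potential_succ_le hm hν hνγ (hM N)]
  linarith [htel N, hlow N]

end StoMADSRun

namespace StoMADSRun

variable {n m : ℕ} {Ω : Type*} {P : Problem n m} {A : Params n} {R : StoMADSRun n m Ω}

/-! ### The past -/

theorem past_mono : Monotone R.past := fun _ _ hkl =>
  iSup_mono fun _ => iSup_mono' fun hl => ⟨hl.trans_le hkl, le_rfl⟩

theorem IsAdapted.past_le [mΩ : MeasurableSpace Ω] (h : R.IsAdapted) (k : ℕ) : R.past k ≤ mΩ := by
  refine iSup_le fun l => iSup_le fun _ => iSup_le fun a => ?_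
  refine sup_le (sup_le (h.meas_F0 l a).comap_le (iSup_le fun i => (h.meas_Fs l a i).comap_le))
    (sup_le (iSup_le fun j => (h.meas_C0 l a j).comap_le)
      (iSup_le fun i => iSup_le fun j => (h.meas_Cs l a i j).comap_le))

/-- The filtration generated by the estimates. -/
def IsAdapted.filtration [mΩ : MeasurableSpace Ω] (h : R.IsAdapted) : Filtration ℕ mΩ where
  seq := R.past
  mono' := past_mono
  le' := h.past_le

theorem measurable_C0_past (k : ℕ) (a : Center) (j : Fin m) :
    Measurable[R.past (k + 1)] (R.C0 k a j) := by
  refine Measurable.mono (comap_measurable _) ?_ le_rfl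
  refine le_iSup_of_le k (le_iSup_of_le k.lt_succ_self (le_iSup_of_le a ?_))
  exact le_sup_of_le_right (le_sup_of_le_left
    (le_iSup (fun j => MeasurableSpace.comap (R.C0 k a j) inferInstance) j))

theorem measurable_Cs_past (k : ℕ) (a : Center) (i : Fin (R.N k)) (j : Fin m) :
    Measurable[R.past (k + 1)] (R.Cs k a i j) := by
  refine Measurable.mono (comap_measurable _) ?_ le_rfl
  refine le_iSup_of_le k (le_iSup_of_le k.lt_succ_self (le_iSup_of_le a ?_))
  exact le_sup_of_le_right (le_sup_of_le_right (le_iSup_of_le i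
    (le_iSup (fun j => MeasurableSpace.comap (R.Cs k a i j) inferInstance) j)))

/-! ### Summability of the squared poll sizes -/

section

variable [mΩ : MeasurableSpace Ω] {μ : Measure Ω}

theorem CondExpLE.integral_mul_le [IsFiniteMeasure μ] {k : ℕ} {Y B w : Ω → ℝ} {c : ℝ}
    (hle : R.past k ≤ mΩ) (h : R.CondExpLE μ Y k B) (hw : StronglyMeasurable[R.past k] w)
    (hw0 : ∀ ω, 0 ≤ w ω) (hwc : ∀ ω, w ω ≤ c) (hB : Integrable (fun ω => w ω * B ω) μ) :
    Integrable (fun ω => w ω * Y ω) μ ∧ ∫ ω, w ω * Y ω ∂μ ≤ ∫ ω, w ω * B ω ∂μ := by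
  have hint : Integrable (fun ω => w ω * Y ω) μ :=
    h.1.bdd_mul (hw.mono hle).aestronglyMeasurable
      (Eventually.of_forall fun ω => by rw [Real.norm_of_nonneg (hw0 ω)]; exact hwc ω)
  refine ⟨hint, ?_⟩
  rw [← integral_condExp hle]
  refine integral_mono_ae integrable_condExp hB ?_
  have hpull : μ[fun ω => w ω * Y ω | R.past k] =ᵐ[μ] w * μ[Y | R.past k] :=
    condExp_mul_of_stronglyMeasurable_left hw hint h.1
  filter_upwards [hpull, h.2] with ω h1 h2
  rw [h1]
  exact mul_le_mul_of_nonneg_left h2 (hw0 ω)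

theorem CondExpLE.integral_le [IsFiniteMeasure μ] {k : ℕ} {Y B : Ω → ℝ} (hle : R.past k ≤ mΩ)
    (h : R.CondExpLE μ Y k B) (hB : Integrable B μ) : ∫ ω, Y ω ∂μ ≤ ∫ ω, B ω ∂μ := by
  simpa using (h.integral_mul_le (w := fun _ => 1) (c := 1) hle stronglyMeasurable_const
    (fun _ => zero_le_one) (fun _ => le_rfl) (by simpa using hB)).2

theorem IsRun.integrable_sq [IsFiniteMeasure μ] (h : R.IsRun P A) (ha : R.IsAdapted) (k : ℕ) :
    Integrable (fun ω => R.δp k ω ^ 2) μ := by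
  have hmeas : Measurable (R.δp k) := (ha.δp_past k).mono (ha.past_le k) le_rfl
  refine Integrable.of_bound (hmeas.pow_const 2).aestronglyMeasurable
    (max A.δ0 ((A.τ : ℝ) ^ A.zhat)⁻¹ ^ 2) (Eventually.of_forall fun ω => ?_)
  rw [Real.norm_of_nonneg (sq_nonneg _)]
  exact pow_le_pow_left₀ (h.δp_pos k ω).le (h.δp_le k ω) 2

theorem div_le_sq_div_add {e ε s D : ℝ} (hε : 0 < ε) (hs : 0 < s) (hD : 0 < D) :
    e / ε ≤ (2 * s * ε ^ 2 * D)⁻¹ * e ^ 2 + s / 2 * D := by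
  have h : 0 ≤ (2 * s * ε ^ 2 * D)⁻¹ * (e - s * ε * D) ^ 2 := by positivity
  have : (2 * s * ε ^ 2 * D)⁻¹ * (e - s * ε * D) ^ 2 =
      (2 * s * ε ^ 2 * D)⁻¹ * e ^ 2 + s / 2 * D - e / ε := by
    field_simp
    ring
  linarith

/-- The expected total error of the estimates is of the order of the squared poll size. -/
theorem exists_totalErr_le [IsProbabilityMeasure μ] (hm : 0 < m) (h : R.IsRun P A)
    (ha : R.IsAdapted) {α β : ℝ} (hβ : β ∈ Ioo (0 : ℝ) 1) (hest : R.EstimatesOK P A μ α β)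
    (k : ℕ) :
    ∃ G : Ω → ℝ, Integrable G μ ∧ (∀ ω, totalErr P A R k ω ≤ G ω) ∧
      ∫ ω, G ω ∂μ ≤ 2 * (√(1 - α) + √(1 - β)) * ∫ ω, R.δp k ω ^ 2 ∂μ := by
  have hε := A.ε_pos
  have hτ := A.τ_cast_pos
  have hle := ha.past_le k
  have hD := h.integrable_sq (μ := μ) ha k
  have hmR : (0 : ℝ) < m := by exact_mod_cast hm
  have hsβ : √β < 1 := by
    rw [Real.sqrt_lt' one_pos]; simpa using hβ.2
  set s := √(1 - √β) with hs
  have hs0 : 0 < s := Real.sqrt_pos.2 (by linarith)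
  have hs2 : s ^ 2 = 1 - √β := Real.sq_sqrt (by linarith)
  have hsle : s ≤ √(1 - β) := by
    refine Real.sqrt_le_sqrt ?_
    have := Real.sq_sqrt hβ.1.le
    nlinarith [Real.sqrt_nonneg β]
  set w : Ω → ℝ := fun ω => (2 * s * A.ε ^ 2 * R.δp k ω ^ 2)⁻¹ with hw
  have hwm' : Measurable[R.past k] w := (((ha.δp_past k).pow_const 2).const_mul _).inv
  have hwm : StronglyMeasurable[R.past k] w := hwm'.stronglyMeasurable
  have hw0 : ∀ ω, 0 ≤ w ω := fun ω => by positivity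
  set q := (A.τ : ℝ) ^ k * min A.δ0 ((A.τ : ℝ) ^ A.zhat)⁻¹ with hq
  have hq0 : 0 < q := mul_pos (pow_pos hτ k) (lt_min A.δ0_pos (by positivity))
  have hwc : ∀ ω, w ω ≤ (2 * s * A.ε ^ 2 * q ^ 2)⁻¹ := fun ω => by
    have := h.le_δp k ω
    simp only [hw]
    gcongr
  have hwB : ∀ ω, w ω * (A.ε ^ 2 * (1 - √β) * R.δp k ω ^ 4) = s / 2 * R.δp k ω ^ 2 := by
    intro ω
    have := h.δp_pos k ω
    simp only [hw]
    rw [← hs2]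
    field_simp
  have hBint : Integrable (fun ω => w ω * (A.ε ^ 2 * (1 - √β) * R.δp k ω ^ 4)) μ := by
    simp_rw [hwB]; exact hD.const_mul _
  have hfs := (hest.f_var_s k).integral_mul_le hle hwm hw0 hwc hBint
  have hf0 := (hest.f_var_0 k).integral_mul_le hle hwm hw0 hwc hBint
  simp_rw [hwB, integral_const_mul] at hfs hf0
  have hhs := (hest.h_mean_s k).integral_le hle (hD.const_mul _)
  have hh0 := (hest.h_mean_0 k).integral_le hle (hD.const_mul _)
  rw [integral_const_mul] at hhs hh0
  have hi1 : Integrable (fun ω => (R.errs P P.h R.hs k ω + R.err0 P.h R.h0 k ω) / (m * A.ε)) μ :=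
    ((hest.h_mean_s k).1.add (hest.h_mean_0 k).1).div_const (m * A.ε)
  have hi2 : Integrable (fun ω => w ω * R.errs P P.f R.Fs k ω ^ 2 +
      w ω * R.err0 P.f R.F0 k ω ^ 2) μ := hfs.1.add hf0.1
  have hi3 : Integrable (fun ω => (w ω * R.errs P P.f R.Fs k ω ^ 2 +
      w ω * R.err0 P.f R.F0 k ω ^ 2) + s * R.δp k ω ^ 2) μ := hi2.add (hD.const_mul s)
  refine ⟨fun ω => (R.errs P P.h R.hs k ω + R.err0 P.h R.h0 k ω) / (m * A.ε) +
    ((w ω * R.errs P P.f R.Fs k ω ^ 2 + w ω * R.err0 P.f R.F0 k ω ^ 2) + s * R.δp k ω ^ 2),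
    hi1.add hi3, fun ω => ?_, ?_⟩
  · have hDω : 0 < R.δp k ω ^ 2 := pow_pos (h.δp_pos k ω) 2
    have h1 := div_le_sq_div_add (e := R.errs P P.f R.Fs k ω) hε hs0 hDω
    have h2 := div_le_sq_div_add (e := R.err0 P.f R.F0 k ω) hε hs0 hDω
    simp only [totalErr, hw]
    rw [add_div _ _ A.ε]
    linarith
  · have e1 : ∫ ω, (R.errs P P.h R.hs k ω + R.err0 P.h R.h0 k ω) / (m * A.ε) ∂μ ≤
        2 * √(1 - α) * ∫ ω, R.δp k ω ^ 2 ∂μ := by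
      rw [integral_div, integral_add (hest.h_mean_s k).1 (hest.h_mean_0 k).1,
        div_le_iff₀ (by positivity)]
      linarith
    have e2 : ∫ ω, (w ω * R.errs P P.f R.Fs k ω ^ 2 + w ω * R.err0 P.f R.F0 k ω ^ 2) ∂μ ≤
        s * ∫ ω, R.δp k ω ^ 2 ∂μ := by
      rw [integral_add hfs.1 hf0.1]
      linarith [hfs.2, hf0.2]
    have e3 : 0 ≤ ∫ ω, R.δp k ω ^ 2 ∂μ := integral_nonneg fun ω => sq_nonneg _
    rw [integral_add hi1 hi3, integral_add hi2 (hD.const_mul s),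
      integral_const_mul]
    have e4 := mul_le_mul_of_nonneg_right hsle e3
    linarith

theorem summable_integral_sq [IsProbabilityMeasure μ] (hm : 0 < m) (h : R.IsRun P A)
    (ha : R.IsAdapted) (hf : ContinuousOn P.f P.X)
    (hU : ∃ U : Set (Vec n), IsCompact U ∧ U ⊆ P.X ∧ ∀ k a ω, R.x k a ω ∈ U)
    {α β ν : ℝ} (hα : α ∈ Ioo (0 : ℝ) 1) (hβ : β ∈ Ioo (0 : ℝ) 1) (hν : ν ∈ Ioo (0 : ℝ) 1)
    (hνγ : 2 * (((A.τ : ℝ) ^ 2)⁻¹ - 1) / (A.γ - 2) ≤ ν / (1 - ν))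
    (hαβν : 4 * ν / ((1 - ν) * (1 - (A.τ : ℝ) ^ 2)) *
      (√(1 - α) + 2 * √(1 - β)) ≤ α * β)
    (hest : R.EstimatesOK P A μ α β) :
    Summable fun k => ∫ ω, R.δp k ω ^ 2 ∂μ := by
  have hε := A.ε_pos
  have hτ := A.τ_cast_pos
  have hτ1 : (A.τ : ℝ) ^ 2 < 1 := pow_lt_one₀ hτ.le A.τ_cast_lt_one two_ne_zero
  obtain ⟨U, hUc, hUX, hxU⟩ := hU
  obtain ⟨C, hC⟩ := hUc.exists_bound_of_continuousOn (hf.mono hUX)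
  have hfC : ∀ k a ω, |P.f (R.x k a ω)| ≤ C := fun k a ω => hC _ (hxU k a ω)
  have h1ν : 0 < 1 - ν := by linarith [hν.2]
  set c := (1 - ν) * (1 - (A.τ : ℝ) ^ 2) with hc
  have hc0 : 0 < c := mul_pos h1ν (by linarith)
  set Q := (1 - ν) * (((A.τ : ℝ) ^ 2)⁻¹ * max A.δ0 ((A.τ : ℝ) ^ A.zhat)⁻¹ ^ 2) with hQ
  set M := C + A.ε / ν * Q with hM
  have hMω : ∀ ω k, (1 - ν) * (((A.τ : ℝ) ^ 2)⁻¹ * R.δp k ω ^ 2) ≤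
      ν * ((M - P.f (R.x (k + 1) Center.feas ω)) / A.ε) := by
    intro ω k
    calc (1 - ν) * (((A.τ : ℝ) ^ 2)⁻¹ * R.δp k ω ^ 2) ≤ Q := by
          have := (h.δp_pos k ω).le
          have := h.δp_le k ω
          simp only [hQ]
          gcongr
      _ = ν * ((A.ε / ν * Q) / A.ε) := by
          have := hν.1
          field_simp
      _ ≤ _ := by
          have := hν.1.le
          have := (abs_le.1 (hfC (k + 1) Center.feas ω)).2
          gcongr
          linarith
  choose G hG hGle hGint using exists_totalErr_le (μ := μ) hm h ha hβ hest
  set Φ := ν * (P.h A.x0 / (m * A.ε) + M / A.ε) + (1 - ν) * A.δ0 ^ 2 with hΦ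
  have hΦω : ∀ ω, potential P A R ν M 0 ω = Φ := fun ω => by
    simp [potential, h.init_x, h.init_flag, h.init_δp, hΦ]
  have hs : 4 * ν * (√(1 - α) + √(1 - β)) ≤ c := by
    rw [div_mul_eq_mul_div, div_le_iff₀ hc0] at hαβν
    have h1 : α * β * c ≤ c :=
      mul_le_of_le_one_left hc0.le (mul_le_one₀ hα.2.le hβ.1.le hβ.2.le)
    have h2 : 4 * ν * (√(1 - α) + √(1 - β)) ≤ 4 * ν * (√(1 - α) + 2 * √(1 - β)) := by
      have := hν.1.le
      gcongr
      linarith [Real.sqrt_nonneg (1 - β)]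
    linarith
  refine summable_of_sum_range_le (c := 2 * (Φ - ν * (-C / A.ε)) / c)
    (fun k => integral_nonneg fun ω => sq_nonneg _) fun N => ?_
  have hint := fun k => h.integrable_sq (μ := μ) ha k
  have hpt : ∀ ω, c * ∑ k ∈ Finset.range N, R.δp k ω ^ 2 ≤
      (Φ - ν * (-C / A.ε)) + ν * ∑ k ∈ Finset.range N, G k ω := by
    intro ω
    have h1 := h.sum_sq_le hm hν hνγ (hMω ω)
      (fun k => (abs_le.1 (hfC k Center.feas ω)).1) N
    rw [hΦω] at h1
    have h2 : ∑ k ∈ Finset.range N, totalErr P A R k ω ≤ ∑ k ∈ Finset.range N, G k ω :=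
      Finset.sum_le_sum fun k _ => hGle k ω
    linarith [mul_le_mul_of_nonneg_left h2 hν.1.le]
  have hmono := integral_mono (μ := μ)
    ((integrable_finsetSum (Finset.range N) fun k _ => hint k).const_mul c)
    ((integrable_const (Φ - ν * (-C / A.ε))).add
      ((integrable_finsetSum (Finset.range N) fun k _ => hG k).const_mul ν)) hpt
  simp only [Pi.add_apply] at hmono
  rw [integral_const_mul, integral_finsetSum _ fun k _ => hint k,
    integral_add (integrable_const _)
      ((integrable_finsetSum (Finset.range N) fun k _ => hG k).const_mul ν),
    integral_const_mul, integral_finsetSum _ fun k _ => hG k, integral_const] at hmono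
  have hsum : ∑ k ∈ Finset.range N, ∫ ω, G k ω ∂μ ≤
      2 * (√(1 - α) + √(1 - β)) * ∑ k ∈ Finset.range N, ∫ ω, R.δp k ω ^ 2 ∂μ := by
    rw [Finset.mul_sum]
    exact Finset.sum_le_sum fun k _ => hGint k
  have hS : 0 ≤ ∑ k ∈ Finset.range N, ∫ ω, R.δp k ω ^ 2 ∂μ :=
    Finset.sum_nonneg fun k _ => integral_nonneg fun ω => sq_nonneg _
  have h1 := mul_le_mul_of_nonneg_left hsum hν.1.le
  have h2 := mul_le_mul_of_nonneg_right hs hS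
  rw [le_div_iff₀ hc0]
  simp only [probReal_univ, smul_eq_mul, one_mul] at hmono
  linarith

theorem ae_tendsto_zero_of_summable_integral {Y : ℕ → Ω → ℝ} (hint : ∀ k, Integrable (Y k) μ)
    (hnn : ∀ k ω, 0 ≤ Y k ω) (hsum : Summable fun k => ∫ ω, Y k ω ∂μ) :
    ∀ᵐ ω ∂μ, Tendsto (fun k => Y k ω) atTop (𝓝 0) := by
  have hne : ∑' k, eLpNorm (Y k) 1 μ ≠ ⊤ := by
    have : ∀ k, eLpNorm (Y k) 1 μ = ENNReal.ofReal (∫ ω, Y k ω ∂μ) := fun k => by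
      rw [eLpNorm_one_eq_lintegral_enorm, ← ofReal_integral_norm_eq_lintegral_enorm (hint k)]
      simp_rw [Real.norm_of_nonneg (hnn k _)]
    simp_rw [this]
    exact hsum.tsum_ofReal_ne_top
  filter_upwards [summable_norm_of_tsum_eLpNorm_ne_top le_rfl (fun k => (hint k).1) hne] with ω hω
  exact tendsto_zero_iff_norm_tendsto_zero.2 hω.tendsto_atTop_zero

end

end StoMADSRun

/-- A random walk whose steps are `1` on events of conditional probability more than one half and
`-1` elsewhere is almost surely unbounded above. -/
theorem ae_not_bddAbove_sum_indicator {Ω : Type*} {mΩ : MeasurableSpace Ω} {μ : Measure Ω}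
    [IsFiniteMeasure μ] (ℱ : Filtration ℕ mΩ) {E : ℕ → Set Ω}
    (hE : ∀ k, MeasurableSet[ℱ (k + 1)] (E k))
    (hp : ∀ k, ∀ᵐ ω ∂μ, 1 / 2 ≤ (μ[(E k).indicator (fun _ => (1 : ℝ)) | ℱ k]) ω) :
    ∀ᵐ ω ∂μ, ¬ BddAbove (range fun N =>
      ∑ k ∈ Finset.range N, (2 * (E k).indicator (fun _ => (1 : ℝ)) ω - 1)) := by
  set V : ℕ → Ω → ℝ := fun N ω =>
    ∑ k ∈ Finset.range N, (2 * (E k).indicator (fun _ => (1 : ℝ)) ω - 1) with hV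
  have hEm : ∀ k, MeasurableSet (E k) := fun k => ℱ.le _ _ (hE k)
  have hint1 : ∀ k, Integrable ((E k).indicator fun _ => (1 : ℝ)) μ := fun k =>
    (integrable_const 1).indicator (hEm k)
  have hint2 : ∀ k, Integrable (fun ω => 2 * (E k).indicator (fun _ => (1 : ℝ)) ω - 1) μ :=
    fun k => ((hint1 k).const_mul 2).sub (integrable_const 1)
  have hstep : ∀ k ω, V (k + 1) ω - V k ω = 2 * (E k).indicator (fun _ => (1 : ℝ)) ω - 1 :=
    fun k ω => by
      simp only [hV, Finset.sum_range_succ]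
      exact add_sub_cancel_left _ _
  have hsub : Submartingale V ℱ μ := by
    refine submartingale_of_condExp_sub_nonneg_nat ?_
      (fun N => integrable_finsetSum _ fun k _ => hint2 k) fun k => ?_
    · intro N
      have : Measurable[ℱ N] (V N) := by
        refine Finset.measurable_fun_sum _ fun k hk => ?_
        refine ((Measurable.indicator measurable_const ?_).const_mul 2).sub_const 1
        exact ℱ.mono (Finset.mem_range.1 hk) _ (hE k)
      exact this.stronglyMeasurable
    · have e : V (k + 1) - V k =
          (2 : ℝ) • (E k).indicator (fun _ => (1 : ℝ)) - fun _ => (1 : ℝ) := by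
        ext ω
        simp [hstep]
      rw [e]
      filter_upwards [hp k, condExp_sub ((hint1 k).smul (2 : ℝ)) (integrable_const (1 : ℝ)) (ℱ k),
        condExp_smul (2 : ℝ) ((E k).indicator fun _ => (1 : ℝ)) (ℱ k)] with ω h1 h2 h3
      rw [h2, Pi.sub_apply, h3, condExp_const (ℱ.le k)]
      simp only [Pi.zero_apply, Pi.smul_apply, smul_eq_mul]
      linarith
  have habs : ∀ k ω, |V (k + 1) ω - V k ω| = 1 := by
    intro k ω
    rw [hstep]
    by_cases hω : ω ∈ E k
    · rw [indicator_of_mem hω]; norm_num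
    · rw [indicator_of_notMem hω]; norm_num
  filter_upwards [hsub.bddAbove_iff_exists_tendsto (R := 1)
    (Eventually.of_forall fun ω k => by simpa using (habs k ω).le)] with ω hω hbdd
  obtain ⟨c, hc⟩ := hω.1 hbdd
  have h0 := ((hc.comp (tendsto_add_atTop_nat 1)).sub hc).abs
  simp only [Function.comp_apply, habs, sub_self, abs_zero] at h0
  exact zero_ne_one (tendsto_nhds_unique h0 tendsto_const_nhds)

/-- A positive sequence whose logarithm follows a walk that is unbounded above is not eventually
bounded by a constant. -/
theorem exists_lt_of_not_bddAbove {δ : ℕ → ℝ} {τ : ℝ} (hτ : 0 < τ) (hτ1 : τ < 1)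
    (hδ : ∀ k, 0 < δ k) {E : ℕ → Prop} [DecidablePred E] {k0 : ℕ}
    (hE : ∀ k, k0 ≤ k → E k → τ⁻¹ * δ k ≤ δ (k + 1)) (hd : ∀ k, k0 ≤ k → τ * δ k ≤ δ (k + 1))
    (hV : ¬ BddAbove (range fun N => ∑ k ∈ Finset.range N, (2 * (if E k then (1 : ℝ) else 0) - 1)))
    (C : ℝ) : ∃ k, k0 ≤ k ∧ C < δ k := by
  by_contra! hcon
  set V : ℕ → ℝ := fun N => ∑ k ∈ Finset.range N, (2 * (if E k then (1 : ℝ) else 0) - 1) with hVdef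
  have hlog : 0 < -Real.log τ := neg_pos.2 (Real.log_neg hτ hτ1)
  have hstep : ∀ k, k0 ≤ k → V k * -Real.log τ - Real.log (δ k) ≤
      V k0 * -Real.log τ - Real.log (δ k0) := by
    intro k hk
    induction k, hk using Nat.le_induction with
    | base => exact le_rfl
    | succ k hk ih =>
      refine le_trans ?_ ih
      have hVk : V (k + 1) = V k + (2 * (if E k then (1 : ℝ) else 0) - 1) :=
        Finset.sum_range_succ _ _
      rw [hVk]
      by_cases hEk : E k
      · have h := Real.log_le_log (mul_pos (inv_pos.2 hτ) (hδ k)) (hE k hk hEk)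
        rw [Real.log_mul (inv_pos.2 hτ).ne' (hδ k).ne', Real.log_inv] at h
        rw [if_pos hEk]
        linarith
      · have h := Real.log_le_log (mul_pos hτ (hδ k)) (hd k hk)
        rw [Real.log_mul hτ.ne' (hδ k).ne'] at h
        rw [if_neg hEk]
        linarith
  refine hV (bddAbove_def.2 ?_)
  obtain ⟨B, hB⟩ := ((Finset.range k0).image V).bddAbove
  refine ⟨max B ((V k0 * -Real.log τ - Real.log (δ k0) + Real.log C) / -Real.log τ), ?_⟩
  rintro _ ⟨N, rfl⟩
  rcases lt_or_ge N k0 with hN | hN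
  · exact le_max_of_le_left (hB (by simpa using ⟨N, hN, rfl⟩))
  · refine le_max_of_le_right ?_
    rw [le_div_iff₀ hlog]
    have := hstep N hN
    have := Real.log_le_log (hδ N) (hcon N hN)
    simp only [hVdef] at *
    linarith

namespace StoMADSRun

variable {n m : ℕ} {Ω : Type*} {P : Problem n m} {A : Params n} {R : StoMADSRun n m Ω}

/-! ### Reliable unsuccessful iterations -/

theorem measurableSet_I [MeasurableSpace Ω] (hX : MeasurableSet P.X) (hh : ContinuousOn P.h P.X)
    {k : ℕ} (hxX : ∀ a ω, R.x k a ω ∈ P.X) (hx : ∀ a, Measurable (R.x k a))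
    (hflag : Measurable (R.flag k)) (hδ : Measurable (R.δp k))
    (hdir : ∀ a i, Measurable (R.dir k a i)) (hC0 : ∀ a j, Measurable (R.C0 k a j))
    (hCs : ∀ a i j, Measurable (R.Cs k a i j)) : MeasurableSet (R.I P A k) := by
  classical
  set g := P.X.indicator P.h with hg
  have hgm : Measurable g := hh.measurable_piecewise continuousOn_const hX
  have hgX : ∀ y ∈ P.X, P.h y = g y := fun y hy => (indicator_of_mem hy _).symm
  have hδm : Measurable (R.δm k) := hδ.min (hδ.pow_const 2)
  have htr : ∀ a i, Measurable (R.trial k a i) := fun a i => (hx a).add (hδm.smul (hdir a i))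
  have hav : ∀ a, MeasurableSet {ω | R.Avail k a ω} := fun a =>
    (MeasurableSet.const _).union (hflag (measurableSet_singleton true))
  have hev : ∀ a i, MeasurableSet {ω | R.Evaluated P k a i ω} := fun a i =>
    (hav a).inter (htr a i hX)
  have hl0 : ∀ a, Measurable (R.l0 A k a) := fun a => Finset.measurable_fun_sum _ fun j _ =>
    ((hC0 a j).sub ((hδ.pow_const 2).const_mul _)).max measurable_const
  have hu0 : ∀ a, Measurable (R.u0 A k a) := fun a => Finset.measurable_fun_sum _ fun j _ =>
    ((hC0 a j).add ((hδ.pow_const 2).const_mul _)).max measurable_const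
  have hls : ∀ a i, Measurable (R.ls A k a i) := fun a i => Finset.measurable_fun_sum _ fun j _ =>
    ((hCs a i j).sub ((hδ.pow_const 2).const_mul _)).max measurable_const
  have hus : ∀ a i, Measurable (R.us A k a i) := fun a i => Finset.measurable_fun_sum _ fun j _ =>
    ((hCs a i j).add ((hδ.pow_const 2).const_mul _)).max measurable_const
  have heq : R.I P A k =
      (⋂ a, {ω | R.Avail k a ω}ᶜ ∪ ({ω | R.l0 A k a ω ≤ g (R.x k a ω)} ∩
        {ω | g (R.x k a ω) ≤ R.u0 A k a ω})) ∩
      ⋂ a, ⋂ i, {ω | R.Evaluated P k a i ω}ᶜ ∪ ({ω | R.ls A k a i ω ≤ g (R.trial k a i ω)} ∩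
        {ω | g (R.trial k a i ω) ≤ R.us A k a i ω}) := by
    ext ω
    simp only [I, mem_ofPred_eq, mem_inter_iff, mem_iInter, mem_union, mem_compl_iff,
      ← imp_iff_not_or]
    refine and_congr (forall_congr' fun a => imp_congr_right fun _ => ?_)
      (forall_congr' fun a => forall_congr' fun i => imp_congr_right fun he => ?_)
    · rw [hgX _ (hxX a ω)]
    · rw [hgX _ he.2]
  rw [heq]
  refine MeasurableSet.inter (MeasurableSet.iInter fun a => ?_)
    (MeasurableSet.iInter fun a => MeasurableSet.iInter fun i => ?_)
  · exact (hav a).compl.union ((measurableSet_le (hl0 a) (hgm.comp (hx a))).inter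
      (measurableSet_le (hgm.comp (hx a)) (hu0 a)))
  · exact (hev a i).compl.union ((measurableSet_le (hls a i) (hgm.comp (htr a i))).inter
      (measurableSet_le (hgm.comp (htr a i)) (hus a i)))

theorem IsAdapted.measurableSet_I_past [MeasurableSpace Ω] (ha : R.IsAdapted)
    (hX : MeasurableSet P.X) (hh : ContinuousOn P.h P.X) (hxX : ∀ k a ω, R.x k a ω ∈ P.X)
    (k : ℕ) : MeasurableSet[R.past (k + 1)] (R.I P A k) := by
  have hle : R.past k ≤ R.past (k + 1) := past_mono k.le_succ
  exact @measurableSet_I _ _ _ _ _ _ (R.past (k + 1)) hX hh _ (hxX k)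
    (fun a => (ha.x_past k a).mono hle le_rfl) ((ha.flag_past k).mono hle le_rfl)
    ((ha.δp_past k).mono hle le_rfl) (fun a i => (ha.dir_past k a i).mono hle le_rfl)
    (fun a j => measurable_C0_past k a j) (fun a i j => measurable_Cs_past k a i j)

theorem IsRun.enlarged_or_unsuccessful (h : R.IsRun P A) (k : ℕ) (ω : Ω) :
    R.δp (k + 1) ω = R.enlarged A k ω ∨
      (R.δp (k + 1) ω = A.τ * R.δp k ω ∧ ¬ ∃ i, R.ImprovesAt P A k i ω) := by
  rcases h.step k ω with ⟨_, _, _, _, _, h, _⟩ | ⟨_, _, _, _, _, h, _⟩ | ⟨_, _, _, _, _, _, _, h, _⟩ |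
    ⟨_, _, hi, _, h, _⟩
  exacts [Or.inl h, Or.inl h, Or.inl h, Or.inr ⟨h, hi⟩]

theorem IsRun.infinite_reliable_unsuccessful (h : R.IsRun P A) {ω : Ω}
    (hδ : Tendsto (fun k => R.δp k ω) atTop (𝓝 0))
    (hV : ¬ BddAbove (range fun N =>
      ∑ k ∈ Finset.range N, (2 * (R.I P A k).indicator (fun _ => (1 : ℝ)) ω - 1))) :
    {k | ω ∈ R.I P A k ∧ ¬ ∃ i, R.ImprovesAt P A k i ω}.Infinite := by
  classical
  have hτ := A.τ_cast_pos
  have hτ1 := A.τ_cast_lt_one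
  intro hfin
  have hQ : 0 < (A.τ : ℝ) * ((A.τ : ℝ) ^ A.zhat)⁻¹ := by positivity
  obtain ⟨k1, hk1⟩ := eventually_atTop.1 (hδ.eventually (gt_mem_nhds hQ))
  obtain ⟨B, hB⟩ := hfin.bddAbove
  have henl : ∀ k, k1 ≤ k → R.enlarged A k ω = (A.τ : ℝ)⁻¹ * R.δp k ω := fun k hk => by
    refine min_eq_left ?_
    rw [inv_mul_le_iff₀ hτ]
    exact (hk1 k hk).le
  obtain ⟨k, hk, hlt⟩ := exists_lt_of_not_bddAbove (k0 := max k1 (B + 1)) hτ hτ1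
    (fun k => h.δp_pos k ω) (E := fun k => ω ∈ R.I P A k)
    (fun k hk hI => by
      rcases h.enlarged_or_unsuccessful k ω with e | ⟨_, hi⟩
      · rw [e, henl k (le_of_max_le_left hk)]
      · have h1 : k ≤ B := hB ⟨hI, hi⟩
        have h2 := le_of_max_le_right hk
        omega)
    (fun k hk => by
      rcases h.enlarged_or_unsuccessful k ω with e | ⟨e, _⟩
      · rw [e, henl k (le_of_max_le_left hk)]
        exact mul_le_mul_of_nonneg_right (hτ1.le.trans ((one_le_inv₀ hτ).2 hτ1.le))
          (h.δp_pos k ω).le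
      · rw [e])
    (by simpa only [indicator_apply] using hV) (max A.δ0 ((A.τ : ℝ) ^ A.zhat)⁻¹)
  exact absurd (h.δp_le k ω) (not_le.2 hlt)

theorem sum_max_add_le {c : Fin m → ℝ} {e : ℝ} (he : 0 ≤ e) :
    ∑ j, max (c j + e) 0 ≤ ∑ j, max (c j) 0 + m * e := by
  have : (m : ℝ) * e = ∑ _j : Fin m, e := by simp
  rw [this, ← Finset.sum_add_distrib]
  refine Finset.sum_le_sum fun j _ => max_le ?_ ?_
  · linarith [le_max_left (c j) 0]
  · linarith [le_max_right (c j) 0]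

theorem IsRun.psi_le_of_reliable (h : R.IsRun P A) {k : ℕ} {ω : Ω} (hI : ω ∈ R.I P A k)
    (hun : ¬ ∃ i, R.ImprovesAt P A k i ω) {d : Vec n} (hd : d ∈ R.pollDirs k Center.inf ω)
    (hX : R.x k Center.inf ω + R.δm k ω • d ∈ P.X) :
    (P.h (R.x k Center.inf ω) - P.h (R.x k Center.inf ω + R.δm k ω • d)) / R.δp k ω ≤
      (A.γ + 2) * m * A.ε * R.δp k ω := by
  obtain ⟨i, rfl⟩ := hd
  have hev : R.Evaluated P k Center.inf i ω := ⟨avail_inf k ω, hX⟩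
  have hD : 0 ≤ A.ε * R.δp k ω ^ 2 := mul_nonneg A.ε_pos.le (sq_nonneg _)
  have h1 := (hI.1 Center.inf (avail_inf k ω)).2
  have h2 := (hI.2 Center.inf i hev).1
  have h3 : R.u0 A k Center.inf ω ≤ R.h0 k Center.inf ω + m * (A.ε * R.δp k ω ^ 2) :=
    sum_max_add_le hD
  have h4 : R.hs k Center.inf i ω ≤ R.ls A k Center.inf i ω + m * (A.ε * R.δp k ω ^ 2) := by
    have := sum_max_add_le (c := fun j => R.Cs k Center.inf i j ω - A.ε * R.δp k ω ^ 2) hD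
    simp only [sub_add_cancel] at this
    exact this
  have h5 : -(A.γ * m * A.ε * R.δp k ω ^ 2) < R.hs k Center.inf i ω - R.h0 k Center.inf ω := by
    by_contra hcon
    exact hun ⟨i, hev, not_lt.1 hcon⟩
  rw [div_le_iff₀ (h.δp_pos k ω)]
  change P.h (R.x k Center.inf ω) - P.h (R.trial k Center.inf i ω) ≤ _
  linarith

/-- From infinitely many reliable unsuccessful iterations one extracts a refining subsequence. -/
theorem IsRun.exists_refining (h : R.IsRun P A) {U : Set (Vec n)} (hUc : IsCompact U)
    {ω : Ω} (hxU : ∀ k a, R.x k a ω ∈ U) (hδ : Tendsto (fun k => R.δp k ω) atTop (𝓝 0))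
    (hinf : {k | ω ∈ R.I P A k ∧ ¬ ∃ i, R.ImprovesAt P A k i ω}.Infinite) :
    ∃ K : Set ℕ, ∃ xhat ∈ U,
      IsRefining (fun k => R.x k Center.inf ω) (fun k => R.δm k ω) K xhat ∧
      PsiLimNonpos P.X P.h (fun k => R.x k Center.inf ω) (fun k => R.δm k ω)
        (fun k => R.δp k ω) (fun k => R.pollDirs k Center.inf ω) K := by
  set S := {k | ω ∈ R.I P A k ∧ ¬ ∃ i, R.ImprovesAt P A k i ω}
  obtain ⟨xhat, hxhat, φ, hφ, hlim⟩ := hUc.tendsto_subseq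
    (x := fun j => R.x (Nat.nth (· ∈ S) j) Center.inf ω) fun j => hxU _ _
  set ψ : ℕ → ℕ := fun j => Nat.nth (· ∈ S) (φ j) with hψ
  have hψm : StrictMono ψ := (Nat.nth_strictMono hinf).comp hφ
  have hle : atTop ⊓ 𝓟 (range ψ) = map ψ atTop := by
    rw [← map_comap, comap_embedding_atTop (fun _ _ => hψm.le_iff_le)
      fun c => ⟨c, hψm.le_apply⟩]
  refine ⟨range ψ, xhat, hxhat, ⟨infinite_range_of_injective hψm.injective, ?_, ?_⟩, ?_⟩
  · rw [hle, tendsto_map'_iff]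
    exact hlim
  · refine Tendsto.mono_left ?_ inf_le_left
    have : Tendsto (fun k => min (R.δp k ω) (R.δp k ω ^ 2)) atTop (𝓝 (min 0 (0 ^ 2))) :=
      hδ.min (hδ.pow 2)
    rwa [zero_pow two_ne_zero, min_self] at this
  · intro η hη
    have h0 : Tendsto (fun k => (A.γ + 2) * m * A.ε * R.δp k ω) atTop (𝓝 0) := by
      simpa using hδ.const_mul ((A.γ + 2) * m * A.ε)
    filter_upwards [(h0.eventually (gt_mem_nhds hη)).filter_mono inf_le_left,
      mem_inf_of_right (mem_principal_self (range ψ))] with k hk hkψ d hd hX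
    obtain ⟨j, rfl⟩ := hkψ
    have hS := Nat.nth_mem_of_infinite hinf (φ j)
    exact (h.psi_le_of_reliable hS.1 hS.2 hd hX).trans hk.le

end StoMADSRun

theorem eventually_add_smul_mem {n : ℕ} {O : Set (Vec n)} {x : ℕ → Vec n} {xhat : Vec n}
    {F : Filter ℕ} (hx : Tendsto x F (𝓝 xhat)) (hO : ∀ᶠ k in F, x k ∈ O) :
    ∀ u ∈ hypertangentCone O xhat, ∃ ε : ℝ, 0 < ε ∧ ∀ᶠ k in F,
      ∀ w ∈ Metric.ball u ε, ∀ t : ℝ, 0 < t → t < ε → x k + t • w ∈ O := by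
  rintro u ⟨ε, hε, h⟩
  refine ⟨ε, hε, ?_⟩
  filter_upwards [hO, hx.eventually (Metric.isOpen_ball.mem_nhds (Metric.mem_ball_self hε))]
    with k h1 h2 using h _ ⟨h1, h2⟩

theorem IsRefining.mem_of_isCompact {n : ℕ} {x : ℕ → Vec n} {δm : ℕ → ℝ} {K : Set ℕ}
    {xhat : Vec n} (h : IsRefining x δm K xhat) {U : Set (Vec n)} (hU : IsCompact U)
    (hx : ∀ k, x k ∈ U) : xhat ∈ U :=
  haveI : (atTop ⊓ 𝓟 K).NeBot :=
    frequently_mem_iff_neBot.1 (Nat.frequently_atTop_iff_infinite.2 h.1)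
  hU.isClosed.mem_of_tendsto h.2.1 (Eventually.of_forall hx)

namespace StoMADSRun

variable {n m : ℕ} {Ω : Type*} {P : Problem n m} {A : Params n} {R : StoMADSRun n m Ω}

theorem IsRun.violation_stationary (h : R.IsRun P A) (hh : LocallyLipschitzOn P.X P.h)
    {U : Set (Vec n)} (hUc : IsCompact U) (hUX : U ⊆ P.X) {ω : Ω} (hxU : ∀ k a, R.x k a ω ∈ U)
    {dmin : ℝ} (hd0 : 0 < dmin)
    (hd : ∀ k a i, R.Avail k a ω → dmin ≤ R.δp k ω * ‖R.dir k a i ω‖) {K : Set ℕ} {xhat : Vec n}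
    (href : IsRefining (fun k => R.x k Center.inf ω) (fun k => R.δm k ω) K xhat)
    (hψ : PsiLimNonpos P.X P.h (fun k => R.x k Center.inf ω) (fun k => R.δm k ω)
      (fun k => R.δp k ω) (fun k => R.pollDirs k Center.inf ω) K)
    (hne : (hypertangentCone P.X xhat).Nonempty)
    (hdense : DirectionsDenseIn (refiningDirections (fun k => R.pollDirs k Center.inf ω) K)
      (hypertangentCone P.X xhat)) :
    IsClarkeStationary P.X P.h P.X xhat := by
  have hX : xhat ∈ P.X := hUX (href.mem_of_isCompact hUc fun k => hxU k _)
  have hxX : ∀ᶠ k in atTop ⊓ 𝓟 K, R.x k Center.inf ω ∈ P.X :=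
    Eventually.of_forall fun k => hUX (hxU k _)
  refine ⟨hX, clarkeDeriv_nonneg_of_refining hh href hX (fun k => h.δp_pos k ω)
    (fun k => rfl) (b := ⨆ j, ‖A.col j‖) (Eventually.of_forall ?_) hd0 (Eventually.of_forall ?_)
    hψ hxX (eventually_add_smul_mem href.2.1 hxX) hne hdense⟩
  · rintro k _ ⟨i, rfl⟩
    exact ((h.poll k _ ω (avail_inf k ω)).2 i).2.2
  · rintro k _ ⟨i, rfl⟩
    exact hd k _ i (avail_inf k ω)

theorem tendsto_h_feas {ω : Ω} {N : ℕ} (hflag : ∀ k, N ≤ k → R.flag k ω = true)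
    (herr : Tendsto (fun k => R.err0 P.h R.h0 k ω) atTop (𝓝 0)) {K : Set ℕ}
    (hh0 : Tendsto (fun k => R.h0 (max k N) Center.feas ω) (atTop ⊓ 𝓟 K) (𝓝 0)) :
    Tendsto (fun k => P.h (R.x (max k N) Center.feas ω)) (atTop ⊓ 𝓟 K) (𝓝 0) := by
  have hmax : Tendsto (fun k => max k N) (atTop ⊓ 𝓟 K) atTop :=
    (tendsto_atTop_mono (fun k => le_max_left k N) tendsto_id).mono_left inf_le_left
  have hdiff : Tendsto (fun k => R.h0 (max k N) Center.feas ω -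
      P.h (R.x (max k N) Center.feas ω)) (atTop ⊓ 𝓟 K) (𝓝 0) :=
    squeeze_zero_norm (fun k => abs_le_err0 (g := P.h) (Or.inr (hflag _ (le_max_right k N))))
      (herr.comp hmax)
  simpa using hh0.sub hdiff

theorem IsRun.objective_stationary (h : R.IsRun P A) (hf : LocallyLipschitzOn P.X P.f)
    (hh : ContinuousOn P.h P.X) {U : Set (Vec n)} (hUc : IsCompact U) (hUX : U ⊆ P.X) {ω : Ω}
    (hxU : ∀ k a, R.x k a ω ∈ U) {dmin : ℝ} (hd0 : 0 < dmin)
    (hd : ∀ k a i, R.Avail k a ω → dmin ≤ R.δp k ω * ‖R.dir k a i ω‖)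
    {N : ℕ} (hflag : ∀ k, N ≤ k → R.flag k ω = true)
    (herr : Tendsto (fun k => R.err0 P.h R.h0 k ω) atTop (𝓝 0)) {K : Set ℕ} {xhat : Vec n}
    (href : IsRefining (fun k => R.x (max k N) Center.feas ω) (fun k => R.δm k ω) K xhat)
    (hψ : PsiLimNonpos P.X P.f (fun k => R.x (max k N) Center.feas ω) (fun k => R.δm k ω)
      (fun k => R.δp k ω) (fun k => R.pollDirs k Center.feas ω) K)
    (hh0 : Tendsto (fun k => R.h0 (max k N) Center.feas ω) (atTop ⊓ 𝓟 K) (𝓝 0)) :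
    xhat ∈ P.feasible ∧
    ((hypertangentCone P.feasible xhat).Nonempty →
      DirectionsDenseIn (refiningDirections (fun k => R.pollDirs k Center.feas ω) K)
        (hypertangentCone P.feasible xhat) →
      ((∀ᶠ k in atTop ⊓ 𝓟 K, R.x (max k N) Center.feas ω ∈ P.feasible) ∨
        hypertangentCone P.feasible xhat ⊆ hypertangentCone P.X xhat) →
      IsClarkeStationary P.X P.f P.feasible xhat) := by
  have hF : (atTop ⊓ 𝓟 K).NeBot :=
    frequently_mem_iff_neBot.1 (Nat.frequently_atTop_iff_infinite.2 href.1)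
  have hX : xhat ∈ P.X := hUX (href.mem_of_isCompact hUc fun k => hxU _ _)
  have hxX : ∀ᶠ k in atTop ⊓ 𝓟 K, R.x (max k N) Center.feas ω ∈ P.X :=
    Eventually.of_forall fun k => hUX (hxU _ _)
  have hhx : Tendsto (fun k => P.h (R.x (max k N) Center.feas ω)) (atTop ⊓ 𝓟 K)
      (𝓝 (P.h xhat)) := (hh xhat hX).tendsto.comp (tendsto_nhdsWithin_iff.2 ⟨href.2.1, hxX⟩)
  have hfeas : xhat ∈ P.feasible :=
    P.mem_feasible_of_h_eq_zero hX (tendsto_nhds_unique hhx (tendsto_h_feas hflag herr hh0))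
  refine ⟨hfeas, fun hne hdense hor => ⟨hfeas, ?_⟩⟩
  have hN : ∀ᶠ k in atTop ⊓ 𝓟 K, N ≤ k := (eventually_ge_atTop N).filter_mono inf_le_left
  refine clarkeDeriv_nonneg_of_refining hf href hX (fun k => h.δp_pos k ω)
    (fun k => rfl) (b := ⨆ j, ‖A.col j‖) (hN.mono ?_) hd0 (hN.mono ?_) hψ hxX ?_ hne hdense
  · rintro k hk _ ⟨i, rfl⟩
    exact ((h.poll k _ ω (Or.inr (hflag k hk))).2 i).2.2
  · rintro k hk _ ⟨i, rfl⟩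
    exact hd k _ i (Or.inr (hflag k hk))
  · intro u hu
    rcases hor with hev | hsub
    · obtain ⟨ε, hε, hεK⟩ := eventually_add_smul_mem href.2.1 hev u hu
      exact ⟨ε, hε, hεK.mono fun k hk w hw t ht htε => (hk w hw t ht htε).1⟩
    · exact eventually_add_smul_mem href.2.1 hxX u (hsub hu)

end StoMADSRun

theorem mainTheorem11 {n m : ℕ} (hm : 0 < m) {Ω : Type*} [MeasurableSpace Ω]
    (μ : Measure Ω) [IsProbabilityMeasure μ]
    (P : Problem n m) (A : Params n) (R : StoMADSRun n m Ω)
    -- regularity of the problem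
    (hX : MeasurableSet P.X)
    (hf : LocallyLipschitzOn P.X P.f) (hh : LocallyLipschitzOn P.X P.h)
    (hc : ∀ j, ContinuousOn (P.c j) P.X)
    (hfb : ∃ κ : ℝ, ∀ x ∈ P.X, κ ≤ P.f x)
    -- `R` is the stochastic process generated by the algorithm
    (hrun : R.IsRun P A) (hadapt : R.IsAdapted)
    (hU : ∃ U : Set (Vec n), IsCompact U ∧ U ⊆ P.X ∧ ∀ k a ω, R.x k a ω ∈ U)
    (hdmin : ∃ dmin : ℝ, 0 < dmin ∧ ∀ k a i ω, R.Avail k a ω →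
      dmin ≤ R.δp k ω * ‖R.dir k a i ω‖)
    (hT : (∀ᵐ ω ∂μ, R.T A ω < ⊤) ∨ (∀ᵐ ω ∂μ, R.T A ω = ⊤))
    -- constants and estimates
    (α β ν : ℝ) (hα : α ∈ Ioo (0 : ℝ) 1) (hβ : β ∈ Ioo (0 : ℝ) 1) (hν : ν ∈ Ioo (0 : ℝ) 1)
    (hνγ : 2 * (((A.τ : ℝ) ^ 2)⁻¹ - 1) / (A.γ - 2) ≤ ν / (1 - ν))
    (hαβν : 4 * ν / ((1 - ν) * (1 - (A.τ : ℝ) ^ 2)) *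
      (Real.sqrt (1 - α) + 2 * Real.sqrt (1 - β)) ≤ α * β)
    (hαβ : α * β ∈ Ioo (1 / 2 : ℝ) 1)
    (hest : R.EstimatesOK P A μ α β) :
    -- results for `h`: existence of the refining subsequence, and stationarity
    ((∀ᵐ ω ∂μ, ∃ (K : Set ℕ) (xhat : Vec n), xhat ∈ P.X ∧
        IsRefining (fun k => R.x k Center.inf ω) (fun k => R.δm k ω) K xhat ∧
        PsiLimNonpos P.X P.h (fun k => R.x k Center.inf ω) (fun k => R.δm k ω)
          (fun k => R.δp k ω) (fun k => R.pollDirs k Center.inf ω) K) ∧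
      (∀ (ω : Ω) (K : Set ℕ) (xhat : Vec n),
        IsRefining (fun k => R.x k Center.inf ω) (fun k => R.δm k ω) K xhat →
        PsiLimNonpos P.X P.h (fun k => R.x k Center.inf ω) (fun k => R.δm k ω)
          (fun k => R.δp k ω) (fun k => R.pollDirs k Center.inf ω) K →
        (hypertangentCone P.X xhat).Nonempty →
        DirectionsDenseIn (refiningDirections (fun k => R.pollDirs k Center.inf ω) K)
          (hypertangentCone P.X xhat) →
        IsClarkeStationary P.X P.h P.X xhat)) ∧
    -- results for `f`
    ((∀ᵐ ω ∂μ, R.T A ω < ⊤) →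
      ∀ᵐ ω ∂μ, ∀ (K : Set ℕ) (xhat : Vec n),
        IsRefining (fun k => R.x (max k (R.T A ω).toNat) Center.feas ω)
          (fun k => R.δm k ω) K xhat →
        PsiLimNonpos P.X P.f (fun k => R.x (max k (R.T A ω).toNat) Center.feas ω)
          (fun k => R.δm k ω) (fun k => R.δp k ω) (fun k => R.pollDirs k Center.feas ω) K →
        Tendsto (fun k => R.h0 (max k (R.T A ω).toNat) Center.feas ω) (atTop ⊓ 𝓟 K) (𝓝 0) →
        xhat ∈ P.feasible ∧
        ((hypertangentCone P.feasible xhat).Nonempty →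
          DirectionsDenseIn (refiningDirections (fun k => R.pollDirs k Center.feas ω) K)
            (hypertangentCone P.feasible xhat) →
          ((∀ᶠ k in atTop ⊓ 𝓟 K,
              R.x (max k (R.T A ω).toNat) Center.feas ω ∈ P.feasible) ∨
            hypertangentCone P.feasible xhat ⊆ hypertangentCone P.X xhat) →
          IsClarkeStationary P.X P.f P.feasible xhat)) := by
  obtain ⟨U, hUc, hUX, hxU⟩ := hU
  obtain ⟨dmin, hd0, hd⟩ := hdmin
  have hsum := StoMADSRun.summable_integral_sq (μ := μ) hm hrun hadapt hf.continuousOn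
    ⟨U, hUc, hUX, hxU⟩ hα hβ hν hνγ hαβν hest
  have hint := fun k => hrun.integrable_sq (μ := μ) hadapt k
  have hδ : ∀ᵐ ω ∂μ, Tendsto (fun k => R.δp k ω) atTop (𝓝 0) := by
    filter_upwards [StoMADSRun.ae_tendsto_zero_of_summable_integral hint
      (fun k ω => sq_nonneg _) hsum] with ω hω
    have := hω.sqrt
    simp_rw [Real.sqrt_sq (hrun.δp_pos _ ω).le, Real.sqrt_zero] at this
    exact this
  refine ⟨⟨?_, fun ω K xhat href hψ hne hdense => hrun.violation_stationary hh hUc hUX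
    (fun k a => hxU k a ω) hd0 (fun k a i => hd k a i ω) href hψ hne hdense⟩, fun hTfin => ?_⟩
  · have hα2 : 1 / 2 ≤ α := hαβ.1.le.trans (mul_le_of_le_one_right hα.1.le hβ.2.le)
    filter_upwards [hδ, ae_not_bddAbove_sum_indicator (μ := μ) hadapt.filtration
      (E := fun k => R.I P A k)
      (fun k => hadapt.measurableSet_I_past hX hh.continuousOn
        (fun k a ω => hUX (hxU k a ω)) k)
      (fun k => (hest.bounds_rel k).mono fun ω hω => hα2.trans hω)] with ω hω hV
    obtain ⟨K, xhat, hx, href, hψ⟩ := hrun.exists_refining hUc (fun k a => hxU k a ω) hω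
      (hrun.infinite_reliable_unsuccessful hω hV)
    exact ⟨K, xhat, hUX hx, href, hψ⟩
  · have herr : ∀ᵐ ω ∂μ, Tendsto (fun k => R.err0 P.h R.h0 k ω) atTop (𝓝 0) := by
      refine StoMADSRun.ae_tendsto_zero_of_summable_integral (fun k => (hest.h_mean_0 k).1)
        (fun k ω => StoMADSRun.err0_nonneg) (Summable.of_nonneg_of_le
          (fun k => integral_nonneg fun ω => StoMADSRun.err0_nonneg) (fun k => ?_)
          (hsum.mul_left (m * A.ε * Real.sqrt (1 - α))))
      rw [← integral_const_mul]
      exact (hest.h_mean_0 k).integral_le (hadapt.past_le k) ((hint k).const_mul _)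
    filter_upwards [hTfin, herr] with ω hTω hω K xhat href hψ hh0
    exact hrun.objective_stationary hf hh.continuousOn hUc hUX (fun k a => hxU k a ω) hd0
      (fun k a i => hd k a i ω) (fun k hk => hrun.flag_of_T_le hTω hk) hω href hψ hh0
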